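/- **Setting.** Fix $M,\sigma>0$ and an integer $\bar K\ge 2$. Let $\mathfrak P_{\mathrm{sg}}$ be the class of stochastic bandit instances $\nu=(\nu_1,\dots,\nu_K)$ with $2\le K\le\bar K$ arms such that every reward distribution $\nu_i$ has mean $\mu_i\in[-M,M]$ and is $\sigma$-sub-Gaussian, i.e. $\int e^{\lambda(x-\mu_i)}\,d\nu_i(x)\le e^{\sigma^2\lambda^2/2}$ for all $\lambda\in\mathbb R$. The rewards $X^i_1,X^i_2,\dots$ of arm $i$ are i.i.d. with law $\nu_i$, independently across arms. A bandit algorithm knows $K$ and the horizon $T$, and in each round $t\le T$ draws an arm $A_t$ from a distribution $\pi_t(\cdot\mid A_1,r_1,\dots,A_{t-1},r_{t-1})$ on the arms, where $r_s=X^{A_s}_{N_{A_s,s}}$ is the reward collected in round $s$ and $N_{i,t}=\sum_{s\le t}\mathbf 1\{A_s=i\}$. Put $\Delta_i=\max_j\mu_j-\mu_i$, $R_T(\nu)=\sum_i\Delta_i\,\mathbb E_\nu[N_{i,T}]$ and $S_T(\nu)=\max_i\sqrt{\operatorname{Var}_\nu(N_{i,T})}$. For a function $f$, UCB-$f$ is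 any algorithm that pulls each arm once in the first $K$ rounds and in each round $t>K$ selects $A_t\in\arg\max_i\{\hat\mu_{i,t-1}+f(t)/\sqrt{N_{i,t-1}}\}$, where $\hat\mu_{i,t-1}$ is the empirical mean of the rewards collected from arm $i$ so far (ties broken arbitrarily). **Statement.** Let $\rho\ge 0$. There is a constant $c_6>0$, depending only on $M,\sigma,\bar K,\rho$ and not on the algorithm, such that under every bandit algorithm $$\liminf_{T\to\infty}\frac{\sup_{\nu\in\mathfrak P_{\mathrm{sg}}}\bigl(R_T(\nu)+S_T(\nu)^\rho\bigr)}{\sqrt T\vee\bigl(T^{\frac{3\rho}{2+2\rho}}\wedge T\bigr)}>c_6 .$$ Furthermore, if $\rho\in[0,2]$, then UCB-$f$ with $f(t)=t^{\left(\frac{2\rho-1}{2+2\rho}\right)^+}\log t$ achieves $$\sup_{\nu\in\mathfrak P_{\mathrm{sg}}}\bigl(R_T(\nu)+S_T(\nu)^\rho\bigr)=\tilde\Theta\Bigl(\sqrt T\vee T^{\frac{3\rho}{2+2\rho}}\Bigr),$$ that is, the left-hand side is, for all large $T$, bounded above and below by positive constants times the argument of $\tilde\Theta$, up to factors that are powers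 of $\log T$. -/

import Mathlib

open MeasureTheory ProbabilityTheory Filter
open scoped ENNReal NNReal

namespace Bandit

/-- A stochastic bandit instance: a number of arms and a reward distribution for each arm. -/
structure Instance where
  numArms : ℕ
  law : Fin numArms → ProbabilityMeasure ℝ

namespace Instance

/-- The mean reward of arm `i`. -/
noncomputable def mean (ν : Instance) (i : Fin ν.numArms) : ℝ :=
  ∫ x, x ∂(ν.law i : Measure ℝ)

/-- The gap between the best mean reward and the mean reward of arm `i`. -/
noncomputable def gap (ν : Instance) (i : Fin ν.numArms) : ℝ :=
  (⨆ j, ν.mean j) - ν.mean i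

end Instance

/-- The class of instances with at least `2` and at most `Kbar` arms, all of whose reward
distributions have mean in `[-M, M]` and are `σ`-sub-Gaussian (around their mean). -/
def subGaussianClass (M σ : ℝ) (Kbar : ℕ) : Set Instance :=
  {ν | 2 ≤ ν.numArms ∧ ν.numArms ≤ Kbar ∧ ∀ i : Fin ν.numArms,
    ν.mean i ∈ Set.Icc (-M) M ∧
    HasSubgaussianMGF (fun x : ℝ => x - ν.mean i) (Real.toNNReal (σ ^ 2))
      (ν.law i : Measure ℝ)}

/-- An observed history of `t` rounds: the successive pairs (arm pulled, reward collected). -/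
abbrev History (K t : ℕ) : Type := Fin t → Fin K × ℝ

/-- A (possibly randomized) bandit algorithm. For each number of arms `K`, horizon `T` and number
`t` of rounds already played, it maps the history of these `t` rounds measurably to a probability
distribution on the arms, from which the arm of round `t + 1` is drawn. -/
structure Algorithm where
  rule : (K T t : ℕ) → Kernel (History K t) (Fin K)
  isMarkov : ∀ K T t : ℕ, 0 < K → IsMarkovKernel (rule K T t)

/-- The law of the table of rewards `x (i, s)`, the reward of the `(s + 1)`-th pull of arm `i`:
all entries are independent, and the entries of row `i` have the distribution of arm `i`. -/
noncomputable def tableLaw (ν : Instance) : Measure (Fin ν.numArms × ℕ → ℝ) :=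
  Measure.infinitePi (fun p : Fin ν.numArms × ℕ => (ν.law p.1 : Measure ℝ))

/-- The number of rounds in which the action sequence `a` pulls arm `i`. -/
def pulls {K T : ℕ} (a : Fin T → Fin K) (i : Fin K) : ℕ :=
  (Finset.univ.filter (fun s : Fin T => a s = i)).card

/-- The first `t` actions of the action sequence `a`. -/
def prefixOf {K T : ℕ} (a : Fin T → Fin K) (t : Fin T) : Fin (t : ℕ) → Fin K :=
  fun s => a ⟨s, s.isLt.trans t.isLt⟩

/-- The reward collected in round `t`: the next unused entry of the row of the arm pulled. -/
def collected {K T : ℕ} (x : Fin K × ℕ → ℝ) (a : Fin T → Fin K) (t : Fin T) : ℝ :=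
  x (a t, pulls (prefixOf a t) (a t))

/-- The history observed before the action of index `t` is chosen, when the reward table is `x`
and the actions are `a`. -/
def observed {K T : ℕ} (x : Fin K × ℕ → ℝ) (a : Fin T → Fin K) (t : Fin T) : History K t :=
  fun s => (prefixOf a t s, collected x a ⟨s, s.isLt.trans t.isLt⟩)

/-- The law of the sequence of the `T` arms pulled by the algorithm on the instance `ν`. Given the
reward table `x`, each action is drawn from the decision rule at the observed history, so that the
sequence `a` has conditional probability `∏ t, π_t (a t | history)`; then `x` is averaged out. -/
noncomputable def actionLaw (alg : Algorithm) (ν : Instance) (T : ℕ) :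
    Measure (Fin T → Fin ν.numArms) :=
  ∑ a : Fin T → Fin ν.numArms,
    (∫⁻ x, ∏ t : Fin T, alg.rule ν.numArms T t (observed x a t) {a t} ∂(tableLaw ν)) •
      Measure.dirac a

/-- The expected pseudo-regret `∑ i, Δ i * E[N_{i,T}]`. -/
noncomputable def regret (alg : Algorithm) (ν : Instance) (T : ℕ) : ℝ :=
  ∑ i, ν.gap i * ∫ a, (pulls a i : ℝ) ∂(actionLaw alg ν T)

/-- The allocation variability: the largest standard deviation of a pull count. -/
noncomputable def variability (alg : Algorithm) (ν : Instance) (T : ℕ) : ℝ :=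
  ⨆ i : Fin ν.numArms, √(variance (fun a => (pulls a i : ℝ)) (actionLaw alg ν T))

/-- The platform's worst-case loss, the supremum of `R_T(ν) + S_T(ν) ^ ρ` over the class. -/
noncomputable def worstLoss (M σ : ℝ) (Kbar : ℕ) (ρ : ℝ) (alg : Algorithm) (T : ℕ) : ℝ≥0∞ :=
  ⨆ ν ∈ subGaussianClass M σ Kbar,
    ENNReal.ofReal (regret alg ν T + (variability alg ν T) ^ ρ)

/-- The number of pulls of arm `i` in a history. -/
def History.count {K t : ℕ} (h : History K t) (i : Fin K) : ℕ :=
  pulls (fun s => (h s).1) i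

/-- The empirical mean reward of arm `i` in a history. -/
noncomputable def History.empMean {K t : ℕ} (h : History K t) (i : Fin K) : ℝ :=
  (∑ s : Fin t, if (h s).1 = i then (h s).2 else 0) / (h.count i : ℝ)

/-- The index `μ̂_i + f(t + 1) / √N_i` of arm `i` in round `t + 1`, after a history of `t`
rounds. -/
noncomputable def ucbIndex (f : ℕ → ℝ) {K t : ℕ} (h : History K t) (i : Fin K) : ℝ :=
  h.empMean i + f (t + 1) / √(h.count i : ℝ)

/-- The algorithm is UCB-f with exploration function `f`: in the first `K` rounds it pulls each
arm once, and in every later round it pulls an arm of maximal index. The order of the first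
`K` pulls and the breaking of ties are arbitrary, possibly random. -/
def IsUCB (f : ℕ → ℝ) (alg : Algorithm) : Prop :=
  ∀ K T t : ℕ, 0 < K → ∀ h : History K t,
    (t < K → alg.rule K T t h {i | h.count i = 0} = 1) ∧
    (K ≤ t → alg.rule K T t h {i | ∀ j, ucbIndex f h j ≤ ucbIndex f h i} = 1)

/-- `u T` is of the order of `v T` up to constants and factors polylogarithmic in `T`. -/
def IsSoftTheta (u : ℕ → ℝ≥0∞) (v : ℕ → ℝ) : Prop :=
  (∃ k : ℕ, ∃ C : ℝ, 0 < C ∧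
    ∀ᶠ T : ℕ in atTop, u T ≤ ENNReal.ofReal (C * v T * Real.log T ^ k)) ∧
  (∃ k : ℕ, ∃ c : ℝ, 0 < c ∧
    ∀ᶠ T : ℕ in atTop, ENNReal.ofReal (c * v T / Real.log T ^ k) ≤ u T)

end Bandit

/-! Both bounds express one trade-off: regret of order `R` is compatible only with variability of
order at least `T ^ (3/2) / R`, and UCB with a suitably inflated bonus attains this up to
logarithms. Equating `R` with `S ^ ρ` gives `R = T ^ (3ρ / (2 + 2ρ))`.

Lower bound. Take two arms with rewards `±σ` and means `θ` and `0`. By Cauchy–Schwarz against the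
likelihood ratio of the reward tables, moving `θ` by `h` of order at most `σ / √T` moves an expected
pull count by at most `S * 2√T h / σ` (`integral_pulls_sub_le`). Chaining such moves from `-δ` to
`δ` bounds the total change by `4 S √T δ / σ`, whereas regret below `δT/4` at both ends forces a
change above `T/2`. Hence `S` exceeds `σ√T / (16δ)` somewhere (`exists_variability_gt`), and `δ`
proportional to (rate)`/T` gives `le_worstLoss`.

Upper bound. Outside an event of probability `O(T⁻³)`, all empirical means of `n ≤ T` rewards are
within `g / √n` of the true ones, with `g` of order `√(log T)`. There UCB follows a deterministic
allocation that splits `τ` pulls so that all noiseless indices `μ_j + f τ / √(n_j)` agree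
(`exists_fluid`), with error of order `(g / f τ) τ` (`IsUCBPath.abs_count_sub_le`). With `f t = t ^
β * log t` this bounds the standard deviation by `O(T ^ (1 - β))`, while the usual argument bounds
the regret by `O(T ^ (β + 1/2) * log T)` (`ucb_bounds`). The stated `β` balances the two. -/

namespace Bandit

/-! ### Action sequences conditionally on the reward table -/

section PathWeight

variable {K T n : ℕ}

/-- The conditional probability, given the reward table `x`, that the first `n` actions of the
algorithm are `b`. -/
noncomputable def pathWeight (alg : Algorithm) (T : ℕ) (x : Fin K × ℕ → ℝ) (b : Fin n → Fin K) :
    ℝ≥0∞ :=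
  ∏ t : Fin n, alg.rule K T t (observed x b t) {b t}

/-- The conditional expectation, given the reward table `x`, of a function of the actions. -/
noncomputable def pathMean (alg : Algorithm) (φ : (Fin T → Fin K) → ℝ) (x : Fin K × ℕ → ℝ) : ℝ :=
  ∑ a : Fin T → Fin K, (pathWeight alg T x a).toReal * φ a

/-- Induction on `n`, summing over the last action first: the history seen before that action does
not depend on it, so its conditional probabilities sum to one. -/
lemma sum_pathWeight (alg : Algorithm) (hK : 0 < K) (x : Fin K × ℕ → ℝ) (n : ℕ) :
    ∑ b : Fin n → Fin K, pathWeight alg T x b = 1 := by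
  induction n with
  | zero => simp [pathWeight]
  | succ n ih =>
    rw [← (Fin.snocEquiv (fun _ : Fin (n + 1) => Fin K)).sum_comp, Fintype.sum_prod_type,
      Finset.sum_comm, ← ih]
    refine Finset.sum_congr rfl fun b _ => ?_
    have hrule : ∀ c : Fin K, pathWeight alg T x (Fin.snoc (α := fun _ => Fin K) b c) =
        pathWeight alg T x b *
          alg.rule K T n (observed x (Fin.snoc (α := fun _ => Fin K) b c) (Fin.last n)) {c} := by
      intro c
      rw [pathWeight, Fin.prod_univ_castSucc]
      have hpre : ∀ t : Fin n, prefixOf (Fin.snoc (α := fun _ => Fin K) b c) t.castSucc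
          = prefixOf b t := by
        intro t
        funext s
        exact Fin.snoc_castSucc (α := fun _ => Fin K) (x := c) (p := b) ⟨s, s.isLt.trans t.isLt⟩
      have hcol : ∀ t : Fin n, collected x (Fin.snoc (α := fun _ => Fin K) b c) t.castSucc
          = collected x b t := by
        intro t
        simp only [collected, Fin.snoc_castSucc]
        rw [hpre]
      congr 1
      · refine Finset.prod_congr rfl fun t _ => ?_
        have : observed x (Fin.snoc (α := fun _ => Fin K) b c) t.castSucc = observed x b t := by
          funext s
          have h1 := congrFun (hpre t) s
          have h2 := hcol ⟨s, s.isLt.trans t.isLt⟩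
          exact Prod.ext h1 h2
        rw [this, Fin.snoc_castSucc]; rfl
      · simp
    have hobs : ∀ c c' : Fin K, observed x (Fin.snoc (α := fun _ => Fin K) b c) (Fin.last n) =
        observed x (Fin.snoc (α := fun _ => Fin K) b c') (Fin.last n) := by
      intro c c'
      have hb : ∀ (c : Fin K) (s : ℕ) (hs : s < n),
          Fin.snoc (α := fun _ => Fin K) b c ⟨s, hs.trans (Nat.lt_succ_self n)⟩ = b ⟨s, hs⟩ :=
        fun c s hs => Fin.snoc_castSucc (α := fun _ => Fin K) (x := c) (p := b) ⟨s, hs⟩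
      funext s
      have hpre : prefixOf (Fin.snoc (α := fun _ => Fin K) b c)
          ⟨s, s.isLt.trans (Nat.lt_succ_self n)⟩ =
          prefixOf (Fin.snoc (α := fun _ => Fin K) b c') ⟨s, s.isLt.trans (Nat.lt_succ_self n)⟩ := by
        funext r
        exact (hb c r (r.isLt.trans s.isLt)).trans (hb c' r (r.isLt.trans s.isLt)).symm
      have h0 := (hb c s s.isLt).trans (hb c' s s.isLt).symm
      refine Prod.ext h0 ?_
      simp only [observed, collected]
      erw [hpre, h0]
    have := alg.isMarkov K T n hK
    obtain ⟨c₀⟩ : Nonempty (Fin K) := ⟨⟨0, hK⟩⟩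
    calc ∑ c : Fin K, pathWeight alg T x (Fin.snoc (α := fun _ => Fin K) b c)
        = ∑ c : Fin K, pathWeight alg T x b *
          alg.rule K T n (observed x (Fin.snoc (α := fun _ => Fin K) b c₀) (Fin.last n)) {c} := by
          refine Finset.sum_congr rfl fun c _ => ?_
          rw [hrule, hobs c c₀]
      _ = pathWeight alg T x b := by
          rw [← Finset.mul_sum, sum_measure_singleton, Finset.coe_univ, measure_univ, mul_one]

lemma pathWeight_le_one (alg : Algorithm) (hK : 0 < K) (x : Fin K × ℕ → ℝ) (b : Fin n → Fin K) :
    pathWeight alg T x b ≤ 1 := by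
  rw [← sum_pathWeight (T := T) alg hK x n]
  exact Finset.single_le_sum (fun _ _ => zero_le) (Finset.mem_univ b)

lemma measurable_pathWeight (alg : Algorithm) (b : Fin n → Fin K) :
    Measurable (fun x => pathWeight alg T x b) := by
  unfold pathWeight
  refine Finset.measurable_fun_prod _ fun t _ => ?_
  refine (Kernel.measurable_coe _ (measurableSet_singleton _)).comp ?_
  refine measurable_pi_lambda _ fun s => ?_
  unfold observed collected
  fun_prop

lemma sum_toReal_pathWeight (alg : Algorithm) (hK : 0 < K) (x : Fin K × ℕ → ℝ) :
    ∑ a : Fin T → Fin K, (pathWeight alg T x a).toReal = 1 := by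
  rw [← ENNReal.toReal_sum fun a _ => ((pathWeight_le_one alg hK x a).trans_lt (by simp)).ne,
    sum_pathWeight alg hK, ENNReal.toReal_one]

lemma measurable_pathMean (alg : Algorithm) (φ : (Fin T → Fin K) → ℝ) :
    Measurable (pathMean alg φ) := by
  unfold pathMean
  exact Finset.measurable_fun_sum _ fun a _ =>
    (measurable_pathWeight alg a).ennreal_toReal.mul_const _

lemma pathMean_mono (alg : Algorithm) {φ ψ : (Fin T → Fin K) → ℝ} (x : Fin K × ℕ → ℝ)
    (h : ∀ a, pathWeight alg T x a ≠ 0 → φ a ≤ ψ a) : pathMean alg φ x ≤ pathMean alg ψ x := by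
  refine Finset.sum_le_sum fun a _ => ?_
  by_cases ha : pathWeight alg T x a = 0
  · simp [ha]
  · exact mul_le_mul_of_nonneg_left (h a ha) ENNReal.toReal_nonneg

lemma pathMean_const (alg : Algorithm) (hK : 0 < K) (x : Fin K × ℕ → ℝ) (c : ℝ) :
    pathMean (T := T) alg (fun _ => c) x = c := by
  rw [pathMean, ← Finset.sum_mul, sum_toReal_pathWeight alg hK, one_mul]

lemma pathMean_sub_const (alg : Algorithm) (hK : 0 < K) (φ : (Fin T → Fin K) → ℝ)
    (x : Fin K × ℕ → ℝ) (c : ℝ) :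
    pathMean alg (fun a => φ a - c) x = pathMean alg φ x - c := by
  conv_rhs => rw [← pathMean_const (T := T) alg hK x c]
  simp only [pathMean, mul_sub, Finset.sum_sub_distrib]

lemma sq_pathMean_le (alg : Algorithm) (hK : 0 < K) (φ : (Fin T → Fin K) → ℝ)
    (x : Fin K × ℕ → ℝ) : pathMean alg φ x ^ 2 ≤ pathMean alg (fun a => φ a ^ 2) x :=
  Real.pow_arith_mean_le_arith_mean_pow_of_even Finset.univ _ φ
    (fun _ _ => ENNReal.toReal_nonneg) (sum_toReal_pathWeight alg hK x) even_two

/-- Within `n` rounds no row is read beyond its first `n` entries. This is what later reduces the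
infinite reward table to a finite product measure. -/
lemma collected_congr {x x' : Fin K × ℕ → ℝ} (h : ∀ p : Fin K × ℕ, p.2 < n → x p = x' p)
    (b : Fin n → Fin K) (t : Fin n) : collected x b t = collected x' b t := by
  refine h _ ?_
  calc pulls (prefixOf b t) (b t) ≤ (Finset.univ : Finset (Fin t)).card := Finset.card_filter_le _ _
    _ = t := by simp
    _ < n := t.isLt

lemma pathWeight_congr (alg : Algorithm) {x x' : Fin K × ℕ → ℝ}
    (h : ∀ p : Fin K × ℕ, p.2 < n → x p = x' p) (b : Fin n → Fin K) :
    pathWeight alg T x b = pathWeight alg T x' b := by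
  refine Finset.prod_congr rfl fun t _ => ?_
  have : observed x b t = observed x' b t :=
    funext fun s => Prod.ext rfl (collected_congr h b _)
  rw [this]

lemma pathMean_congr (alg : Algorithm) (φ : (Fin T → Fin K) → ℝ) {x x' : Fin K × ℕ → ℝ}
    (h : ∀ p : Fin K × ℕ, p.2 < T → x p = x' p) : pathMean alg φ x = pathMean alg φ x' :=
  Finset.sum_congr rfl fun a _ => by rw [pathWeight_congr alg h]

lemma rule_ne_zero_of_pathWeight_ne_zero {alg : Algorithm} {x : Fin K × ℕ → ℝ}
    {b : Fin n → Fin K} (hb : pathWeight alg T x b ≠ 0) (t : Fin n) :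
    alg.rule K T t (observed x b t) {b t} ≠ 0 :=
  Finset.prod_ne_zero_iff.1 hb t (Finset.mem_univ t)

/-- Converts the probability-one clauses of `IsUCB` into pointwise facts about every action sequence
of positive weight, so that the analysis of UCB becomes deterministic. -/
lemma mem_of_pathWeight_ne_zero {alg : Algorithm} (hK : 0 < K) {x : Fin K × ℕ → ℝ}
    {b : Fin n → Fin K} (hb : pathWeight alg T x b ≠ 0) (t : Fin n) {s : Set (Fin K)}
    (hs : alg.rule K T t (observed x b t) s = 1) : b t ∈ s := by
  by_contra hbt
  have := alg.isMarkov K T t hK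
  refine rule_ne_zero_of_pathWeight_ne_zero hb t (measure_mono_null
    (Set.singleton_subset_iff.2 (show b t ∈ sᶜ from hbt)) ?_)
  rw [measure_compl s.toFinite.measurableSet (measure_ne_top _ _), hs, measure_univ, tsub_self]

end PathWeight

/-! ### Averaging over the reward table -/

section ActionLaw

variable {ν : Instance} {T : ℕ}

instance isProbabilityMeasure_tableLaw (ν : Instance) : IsProbabilityMeasure (tableLaw ν) := by
  unfold tableLaw; infer_instance

lemma integrable_pathMean (alg : Algorithm) (hK : 0 < ν.numArms)
    (φ : (Fin T → Fin ν.numArms) → ℝ) (μ : Measure (Fin ν.numArms × ℕ → ℝ)) [IsFiniteMeasure μ] :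
    Integrable (pathMean alg φ) μ := by
  refine Integrable.of_bound (measurable_pathMean alg φ).aestronglyMeasurable
    (∑ a, |φ a|) (ae_of_all _ fun x => ?_)
  refine (Finset.abs_sum_le_sum_abs _ _).trans (Finset.sum_le_sum fun a _ => ?_)
  rw [abs_mul, abs_of_nonneg ENNReal.toReal_nonneg]
  exact mul_le_of_le_one_left (abs_nonneg _)
    (ENNReal.toReal_le_of_le_ofReal zero_le_one (by simpa using pathWeight_le_one alg hK x a))

lemma lintegral_pathWeight_le_one (alg : Algorithm) (hK : 0 < ν.numArms)
    (a : Fin T → Fin ν.numArms) : ∫⁻ x, pathWeight alg T x a ∂tableLaw ν ≤ 1 :=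
  (lintegral_mono fun x => pathWeight_le_one alg hK x a).trans (by simp)

lemma actionLaw_eq_sum (alg : Algorithm) (ν : Instance) (T : ℕ) :
    actionLaw alg ν T = ∑ a : Fin T → Fin ν.numArms,
      (∫⁻ x, pathWeight alg T x a ∂tableLaw ν) • Measure.dirac a := rfl

lemma isProbabilityMeasure_actionLaw (alg : Algorithm) (hK : 0 < ν.numArms) :
    IsProbabilityMeasure (actionLaw alg ν T) where
  measure_univ := by
    rw [actionLaw_eq_sum]
    simp only [Measure.coe_finsetSum, Finset.sum_apply, Measure.smul_apply, measure_univ,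
      smul_eq_mul, mul_one]
    rw [← lintegral_finsetSum _ fun a _ => measurable_pathWeight alg a]
    simp [sum_pathWeight alg hK]

lemma integral_actionLaw (alg : Algorithm) (hK : 0 < ν.numArms)
    (φ : (Fin T → Fin ν.numArms) → ℝ) :
    ∫ a, φ a ∂actionLaw alg ν T = ∫ x, pathMean alg φ x ∂tableLaw ν := by
  have hlt : ∀ a : Fin T → Fin ν.numArms, ∫⁻ x, pathWeight alg T x a ∂tableLaw ν ≠ ∞ :=
    fun a => ((lintegral_pathWeight_le_one alg hK a).trans_lt (by simp)).ne
  have hW : ∀ (a : Fin T → Fin ν.numArms) (x), (pathWeight alg T x a).toReal ≤ 1 := fun a x =>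
    ENNReal.toReal_le_of_le_ofReal zero_le_one (by simpa using pathWeight_le_one alg hK x a)
  rw [actionLaw_eq_sum, integral_finsetSum_measure fun a _ =>
    (integrable_dirac (by simp)).smul_measure (hlt a)]
  unfold pathMean
  rw [integral_finsetSum _ fun a _ => Integrable.mul_const (Integrable.of_bound
    (measurable_pathWeight alg a).ennreal_toReal.aestronglyMeasurable 1 (ae_of_all _ fun x => by
      simpa using hW a x)) _]
  refine Finset.sum_congr rfl fun a _ => ?_
  rw [integral_smul_measure, integral_dirac, integral_mul_const, smul_eq_mul,
    integral_toReal (measurable_pathWeight alg a).aemeasurable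
      (ae_of_all _ fun x => (pathWeight_le_one alg hK x a).trans_lt (by simp))]

lemma integrable_pathMean_tableLaw (alg : Algorithm) (hK : 0 < ν.numArms)
    (φ : (Fin T → Fin ν.numArms) → ℝ) : Integrable (pathMean alg φ) (tableLaw ν) :=
  integrable_pathMean alg hK φ _

/-- Conditional Jensen: averaging out the algorithm's own randomization can only reduce the spread.
It lets a change of measure on tables be controlled by the variance of the actual pull counts. -/
lemma integral_sq_pathMean_sub_le (alg : Algorithm) (hK : 0 < ν.numArms)
    (φ : (Fin T → Fin ν.numArms) → ℝ) (c : ℝ) :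
    ∫ x, (pathMean alg φ x - c) ^ 2 ∂tableLaw ν ≤ ∫ a, (φ a - c) ^ 2 ∂actionLaw alg ν T := by
  rw [integral_actionLaw alg hK]
  refine integral_mono_of_nonneg (ae_of_all _ fun x => sq_nonneg _)
    (integrable_pathMean_tableLaw alg hK _) (ae_of_all _ fun x => ?_)
  have h := sq_pathMean_le alg hK (fun a => φ a - c) x
  rw [pathMean_sub_const alg hK] at h
  exact h

/-- If a function of the actions is at most `B` on all action sequences compatible with a reward
table outside of `N`, then its expectation is at most `B` up to the contribution of `N`. -/
lemma integral_actionLaw_le (alg : Algorithm) (hK : 0 < ν.numArms)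
    (φ : (Fin T → Fin ν.numArms) → ℝ) {B C : ℝ}
    {N : Set (Fin ν.numArms × ℕ → ℝ)} (hN : MeasurableSet N)
    (hB : ∀ x ∉ N, ∀ a, pathWeight alg T x a ≠ 0 → φ a ≤ B) (hφ : ∀ a, φ a ≤ B + C) :
    ∫ a, φ a ∂actionLaw alg ν T ≤ B + C * (tableLaw ν).real N := by
  rw [integral_actionLaw alg hK]
  calc ∫ x, pathMean alg φ x ∂tableLaw ν
      ≤ ∫ x, (B + N.indicator (fun _ => C) x) ∂tableLaw ν := by
        refine integral_mono (integrable_pathMean alg hK φ _)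
          ((integrable_const B).add ((integrable_const C).indicator hN)) fun x => ?_
        by_cases hx : x ∈ N
        · simp only [hx, Set.indicator_of_mem]
          exact (pathMean_mono alg x fun a _ => hφ a).trans_eq (pathMean_const alg hK x _)
        · simp only [hx, not_false_eq_true, Set.indicator_of_notMem, add_zero]
          exact (pathMean_mono alg x (hB x hx)).trans_eq (pathMean_const alg hK x _)
    _ = B + C * (tableLaw ν).real N := by
        rw [integral_add (integrable_const B) ((integrable_const C).indicator hN),
          integral_indicator hN]
        simp [mul_comm]

end ActionLaw

/-! ### Pull counts along a deterministic action sequence -/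

section Count

variable {K : ℕ}

/-- The number of rounds before round `t` in which the action sequence `act` pulls arm `i`. -/
def count (act : ℕ → Fin K) (i : Fin K) (t : ℕ) : ℕ :=
  ((Finset.range t).filter (fun s => act s = i)).card

variable {act : ℕ → Fin K} {i : Fin K} {t T : ℕ}

lemma count_succ (act : ℕ → Fin K) (i : Fin K) (t : ℕ) :
    count act i (t + 1) = count act i t + if act t = i then 1 else 0 := by
  unfold count
  rw [Finset.range_add_one, Finset.filter_insert]
  split_ifs <;> simp

lemma count_zero (act : ℕ → Fin K) (i : Fin K) : count act i 0 = 0 := by simp [count]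

lemma count_mono (act : ℕ → Fin K) (i : Fin K) : Monotone (count act i) :=
  monotone_nat_of_le_succ fun t => by rw [count_succ]; exact Nat.le_add_right _ _

lemma count_le (act : ℕ → Fin K) (i : Fin K) (t : ℕ) : count act i t ≤ t :=
  (Finset.card_filter_le _ _).trans (by simp)

lemma sum_count (act : ℕ → Fin K) (t : ℕ) : ∑ i, count act i t = t := by
  induction t with
  | zero => simp [count_zero]
  | succ t ih => simp [count_succ, Finset.sum_add_distrib, ih]

/-- UCB gives information on an arm only in rounds where it is pulled; its last pull carries such
information to the horizon at the cost of one pull. -/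
lemma exists_last_pull (h : 0 < count act i T) :
    ∃ t < T, act t = i ∧ count act i t + 1 = count act i T := by
  induction T with
  | zero => simp [count_zero] at h
  | succ T ih =>
    by_cases hT : act T = i
    · exact ⟨T, Nat.lt_succ_self T, hT, by simp [count_succ, hT]⟩
    · have heq : count act i (T + 1) = count act i T := by simp [count_succ, hT]
      obtain ⟨t, ht, h1, h2⟩ := ih (heq ▸ h)
      exact ⟨t, ht.trans (Nat.lt_succ_self T), h1, h2.trans heq.symm⟩

lemma count_le_one (hinit : ∀ t < T, t < K → count act (act t) t = 0) (htT : t ≤ T) (htK : t ≤ K) :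
    count act i t ≤ 1 := by
  rcases Nat.eq_zero_or_pos (count act i t) with h | h
  · omega
  · obtain ⟨r, hr, h1, h2⟩ := exists_last_pull h
    have := hinit r (hr.trans_le htT) (hr.trans_le htK)
    rw [h1] at this
    omega

/-- After `K` initial rounds the `K` counts are at most one and sum to `K`, so each equals one. -/
lemma count_pos (hinit : ∀ t < T, t < K → count act (act t) t = 0) (htT : t ≤ T) (hKt : K ≤ t)
    (i : Fin K) : 0 < count act i t := by
  refine lt_of_lt_of_le ?_ (count_mono act i hKt)
  have hle : ∀ j, count act j K ≤ 1 := fun j => count_le_one hinit (hKt.trans htT) le_rfl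
  have hsum : ∑ j, count act j K = ∑ _j : Fin K, 1 := by rw [sum_count]; simp
  have := (Finset.sum_eq_sum_iff_of_le fun j _ => hle j).1 hsum i (Finset.mem_univ i)
  omega

/-- The actions `act` of the first `T` rounds are those of UCB-`f` when `m i n` is the mean of the
first `n` rewards of arm `i`. -/
structure IsUCBPath (f : ℕ → ℝ) (m : Fin K → ℕ → ℝ) (act : ℕ → Fin K) (T : ℕ) : Prop where
  init : ∀ t < T, t < K → count act (act t) t = 0
  argmax : ∀ t < T, K ≤ t → ∀ j, m j (count act j t) + f (t + 1) / √(count act j t : ℝ) ≤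
    m (act t) (count act (act t) t) + f (t + 1) / √(count act (act t) t : ℝ)

end Count

/-! ### UCB paths on the good event -/

section Path

variable {K T : ℕ} {f : ℕ → ℝ} {m : Fin K → ℕ → ℝ} {act : ℕ → Fin K} {μ : Fin K → ℝ} {g : ℝ}

lemma IsUCBPath.mean_add_le (h : IsUCBPath f m act T)
    (hm : ∀ i n, 1 ≤ n → n ≤ T → |m i n - μ i| ≤ g / √(n : ℝ)) {t : ℕ} (ht : t < T) (hK : K ≤ t)
    (j : Fin K) : μ j + (f (t + 1) - g) / √(count act j t : ℝ) ≤
      μ (act t) + (f (t + 1) + g) / √(count act (act t) t : ℝ) := by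
  have hpos := count_pos h.init ht.le hK
  have hle : ∀ i, count act i t ≤ T := fun i => (count_le act i t).trans ht.le
  have h1 := (abs_le.1 (hm j _ (hpos j) (hle j))).1
  have h2 := (abs_le.1 (hm (act t) _ (hpos (act t)) (hle (act t)))).2
  have h3 := h.argmax t ht hK j
  rw [sub_div, add_div]
  linarith

/-- At the last pull of `i`, its index is at least that of `b`, which is at least `μ b` once `f`
dominates the noise level `g`. So the gap is at most `2F / √n` for the current count `n`; multiply
by `n ≤ T`. The `-1` is the last pull itself, and the term in `s` covers counts too small to ensure
that `f` dominates `g`. -/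
lemma IsUCBPath.gap_mul_le (h : IsUCBPath f m act T)
    (hm : ∀ i n, 1 ≤ n → n ≤ T → |m i n - μ i| ≤ g / √(n : ℝ)) {F : ℝ} {s : ℕ}
    (hF : ∀ t ≤ T, f t ≤ F) (hF0 : 0 ≤ F) (hg : ∀ t, s ≤ t → g ≤ f (t + 1)) (i b : Fin K)
    (hib : μ i ≤ μ b) :
    (μ b - μ i) * (count act i T - 1) ≤ 2 * F * √(T : ℝ) + (μ b - μ i) * s := by
  have hΔ : 0 ≤ μ b - μ i := sub_nonneg.2 hib
  have hR : 0 ≤ 2 * F * √(T : ℝ) := by positivity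
  rcases le_or_gt (count act i T) 1 with h1 | h1
  · have h1' : (count act i T : ℝ) ≤ 1 := by exact_mod_cast h1
    nlinarith [mul_nonneg hΔ (Nat.cast_nonneg (α := ℝ) s), mul_nonneg hΔ (sub_nonneg.2 h1')]
  obtain ⟨t, ht, hact, hcount⟩ := exists_last_pull (zero_lt_one.trans h1)
  have hc : (count act i T : ℝ) - 1 = count act i t := by
    rw [← hcount]; push_cast; ring
  rw [hc]
  rcases le_or_gt (count act i t) s with hs | hs
  · have : (count act i t : ℝ) ≤ s := by exact_mod_cast hs
    nlinarith [mul_le_mul_of_nonneg_left this hΔ]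
  have hKt : K ≤ t := by
    by_contra hlt
    have := h.init t ht (not_le.1 hlt)
    rw [hact] at this
    omega
  have hst : s ≤ t := hs.le.trans (count_le act i t)
  have key := h.mean_add_le hm ht hKt b
  rw [hact] at key
  have hn : (0 : ℝ) < count act i t := by exact_mod_cast (by omega : 0 < count act i t)
  have hnT : (count act i t : ℝ) ≤ T := by exact_mod_cast (count_le act i t).trans ht.le
  have h2 : 0 ≤ (f (t + 1) - g) / √(count act b t : ℝ) :=
    div_nonneg (sub_nonneg.2 (hg t hst)) (Real.sqrt_nonneg _)
  have h3 : (f (t + 1) + g) / √(count act i t : ℝ) ≤ 2 * F / √(count act i t : ℝ) := by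
    gcongr
    have := hF (t + 1) ht
    have := hg t hst
    linarith
  have h4 : μ b - μ i ≤ 2 * F / √(count act i t : ℝ) := by linarith
  calc (μ b - μ i) * count act i t ≤ 2 * F / √(count act i t : ℝ) * count act i t := by gcongr
    _ = 2 * F * √(count act i t : ℝ) := by
      rw [div_mul_eq_mul_div, mul_div_assoc, Real.div_sqrt]
    _ ≤ 2 * F * √(T : ℝ) := by gcongr
    _ ≤ _ := by
      have := mul_nonneg hΔ (Nat.cast_nonneg (α := ℝ) s)
      linarith

/-- In a round in which arm `i` is pulled, it has not been pulled much more often than in the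
noiseless allocation `n`, which equalizes the indices. -/
lemma IsUCBPath.count_add_one_le (h : IsUCBPath f m act T)
    (hm : ∀ i n, 1 ≤ n → n ≤ T → |m i n - μ i| ≤ g / √(n : ℝ)) {t : ℕ} (ht : t < T) (hKt : K ≤ t)
    (hg : 0 ≤ g) (hgf : g < f (t + 1)) {n : Fin K → ℝ} {lam D : ℝ} (hn : ∀ j, 0 < n j)
    (hlam : ∀ j, μ j + f (t + 1) / √(n j) = lam) (hsum : ∑ j, n j = (t + 1 : ℕ))
    (hD : 3 * K * (g / f (t + 1)) * (t + 1 : ℕ) + 1 ≤ D) :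
    (count act (act t) t : ℝ) + 1 ≤ n (act t) + D := by
  by_contra! hlt
  set i := act t
  set F := f (t + 1)
  set τ : ℝ := ((t + 1 : ℕ) : ℝ)
  have hF : 0 < F := hg.trans_lt hgf
  have hτ : 0 < τ := by positivity
  -- The relative noise. The factor `3` in `D` comes from `(1 + ε)² ≤ 1 + 3ε` for `ε ≤ 1` and `(1 -
  -- ε)² ≥ 1 - 3ε`.
  set ε := g / F
  have hε : 0 ≤ ε := by positivity
  have hε1 : ε < 1 := (div_lt_one hF).2 hgf
  have hgε : g = ε * F := by simp [ε, hF.ne']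
  have hK1 : (1 : ℝ) ≤ K := by exact_mod_cast (Nat.lt_of_le_of_lt (Nat.zero_le _) i.isLt)
  have hnτ : ∀ j, n j ≤ τ := fun j =>
    (Finset.single_le_sum (fun k _ => (hn k).le) (Finset.mem_univ j)).trans_eq hsum
  have hετ : 0 ≤ ε * τ := by positivity
  have hpos := count_pos h.init ht.le hKt
  have hDK : 3 * (ε * τ) * K + 1 ≤ D := by linarith
  -- The counts sum to `t` and the allocation to `t + 1`, so a large excess on arm `i` forces a
  -- deficit above `3ετ` on some arm `j`. Both deviations exceed what the noise can hide, so `j`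
  -- would have had a larger index than `i`, as their noiseless indices at `n` coincide.
  obtain ⟨j, hj⟩ : ∃ j, (count act j t : ℝ) < n j - 3 * (ε * τ) := by
    by_contra! hge
    have h1 : ∑ j, ((count act j t : ℝ) - n j) = -1 := by
      rw [Finset.sum_sub_distrib, hsum, ← Nat.cast_sum, sum_count]
      simp [τ]
    have h2 : ∑ _j : Fin K, (-(3 * (ε * τ)) : ℝ) = -(3 * (ε * τ) * K) := by simp; ring
    have hlt1 : ∑ _j : Fin K, (-(3 * (ε * τ)) : ℝ) + D - 1 < ∑ j, ((count act j t : ℝ) - n j) := by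
      rw [← Finset.add_sum_erase _ _ (Finset.mem_univ i), ← Finset.add_sum_erase (a := i) _
        (fun j => (count act j t : ℝ) - n j) (Finset.mem_univ i)]
      have h4 : ∑ j ∈ Finset.univ.erase i, (-(3 * (ε * τ)) : ℝ) ≤
          ∑ j ∈ Finset.univ.erase i, ((count act j t : ℝ) - n j) :=
        Finset.sum_le_sum fun j _ => by linarith [hge j]
      linarith
    linarith
  have hcj : (0 : ℝ) < count act j t := by exact_mod_cast hpos j
  have hci : (0 : ℝ) < count act i t := by exact_mod_cast hpos i
  have key := h.mean_add_le hm ht hKt j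
  have hj' : F / √(n j) < (F - g) / √(count act j t : ℝ) := by
    rw [div_lt_div_iff₀ (Real.sqrt_pos.2 (hn j)) (Real.sqrt_pos.2 hcj), hgε]
    have : √(count act j t : ℝ) < (1 - ε) * √(n j) := by
      rw [Real.sqrt_lt' (by have := Real.sqrt_pos.2 (hn j); nlinarith), mul_pow,
        Real.sq_sqrt (hn j).le]
      have := mul_le_mul_of_nonneg_left (hnτ j) hε
      nlinarith [sq_nonneg ε, hn j, mul_nonneg (sq_nonneg ε) (hn j).le]
    nlinarith
  have hi' : (F + g) / √(count act i t : ℝ) ≤ F / √(n i) := by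
    rw [div_le_div_iff₀ (Real.sqrt_pos.2 hci) (Real.sqrt_pos.2 (hn i)), hgε]
    have : (1 + ε) * √(n i) ≤ √(count act i t : ℝ) := by
      refine Real.le_sqrt_of_sq_le ?_
      rw [mul_pow, Real.sq_sqrt (hn i).le]
      have h1 := mul_le_mul_of_nonneg_left (hnτ i) hε
      have h2 : ε * (ε * n i) ≤ 1 * (ε * n i) :=
        mul_le_mul_of_nonneg_right hε1.le (mul_nonneg hε (hn i).le)
      have h3 : 3 * (ε * τ) * 1 ≤ 3 * (ε * τ) * K := by gcongr
      nlinarith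
    nlinarith
  have := hlam i
  have := hlam j
  linarith

/-- The pull counts are close to the noiseless allocation `n`. -/
lemma IsUCBPath.abs_count_sub_le (h : IsUCBPath f m act T)
    (hm : ∀ i n, 1 ≤ n → n ≤ T → |m i n - μ i| ≤ g / √(n : ℝ)) {s : ℕ} (hg : 0 ≤ g)
    (hKs : K ≤ s) (hsT : s ≤ T) (hgf : ∀ τ, s ≤ τ → g < f τ) {n : ℕ → Fin K → ℝ} {D : ℝ}
    (hn : ∀ τ, s ≤ τ → ∀ j, 0 < n τ j)
    (hlam : ∀ τ, s ≤ τ → ∃ lam, ∀ j, μ j + f τ / √(n τ j) = lam)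
    (hsum : ∀ τ, s ≤ τ → ∑ j, n τ j = τ)
    (hmono : ∀ τ, s ≤ τ → ∀ j, n τ j ≤ n (τ + 1) j)
    (hsD : s ≤ D) (hD : ∀ τ, s ≤ τ → τ ≤ T → 3 * K * (g / f τ) * τ + 1 ≤ D) (i : Fin K) :
    |(count act i T : ℝ) - n T i| ≤ K * D := by
  have hD0 : 0 ≤ D := (Nat.cast_nonneg s).trans hsD
  have hup : ∀ i, (count act i T : ℝ) ≤ n T i + D := by
    intro i
    rcases le_or_gt (count act i T) s with hs | hs
    · have : (count act i T : ℝ) ≤ s := by exact_mod_cast hs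
      linarith [hn T hsT i]
    obtain ⟨t, ht, hact, hcount⟩ := exists_last_pull (i := i) (T := T) (act := act) (by omega)
    have hst : s ≤ t := by
      have := count_le act i t
      omega
    obtain ⟨lam, hl⟩ := hlam (t + 1) (by omega)
    have h1 := h.count_add_one_le hm ht (hKs.trans hst) hg (hgf _ (by omega)) (hn _ (by omega)) hl
      (hsum (t + 1) (by omega)) (hD (t + 1) (by omega) ht)
    rw [hact] at h1
    have h2 : n (t + 1) i ≤ n T i :=
      Nat.le_induction (m := t + 1) (P := fun r _ => n (t + 1) i ≤ n r i) le_rfl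
        (fun r hr ih => ih.trans (hmono r (by omega) i)) T ht
    have h3 : (count act i T : ℝ) = count act i t + 1 := by rw [← hcount]; push_cast; ring
    linarith
  -- The lower bound follows from the upper one: both allocations have total `T`, so a deficit of
  -- arm `i` is at most the sum of the excesses of the other `K - 1` arms.
  have hKc : (K : ℝ) = (Finset.univ.erase i).card + 1 := by
    rw [Finset.card_erase_of_mem (Finset.mem_univ i), Finset.card_univ, Fintype.card_fin]
    have : 1 ≤ K := Nat.lt_of_le_of_lt (Nat.zero_le _) i.isLt
    push_cast [this]; ring
  have hrest : ∑ j ∈ Finset.univ.erase i, ((count act j T : ℝ) - n T j) ≤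
      (Finset.univ.erase i).card * D := by
    rw [← nsmul_eq_mul]
    exact Finset.sum_le_card_nsmul _ _ _ fun j _ => by linarith [hup j]
  have htot : ((count act i T : ℝ) - n T i) +
      ∑ j ∈ Finset.univ.erase i, ((count act j T : ℝ) - n T j) = 0 := by
    rw [Finset.add_sum_erase _ (fun j => (count act j T : ℝ) - n T j) (Finset.mem_univ i),
      Finset.sum_sub_distrib, hsum T hsT, ← Nat.cast_sum, sum_count, sub_self]
  have hc : 0 ≤ ((Finset.univ.erase i).card : ℝ) * D := by positivity
  rw [abs_le, hKc]
  constructor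
  · nlinarith
  · nlinarith [hup i]

end Path

/-! ### The noiseless allocation -/

section Fluid

variable {K : ℕ} {Δ : Fin K → ℝ} {b : Fin K}

/-- With `A = F ^ 2`, the unknown `x` is the excess of the common index over the best mean, so arm
`j` receives `A / (x + Δ j) ^ 2`. Intermediate value theorem between `l`, where the best arm alone
takes `τ`, and `u`, where every arm takes at most `τ / K`; `x ≤ u` leaves at least `τ / K` to the
best arm. -/
lemma exists_sum_div_sq_eq (hΔ : ∀ j, 0 ≤ Δ j) (hb : Δ b = 0) {A τ : ℝ} (hA : 0 < A) (hτ : 0 < τ) :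
    ∃ x, 0 < x ∧ τ / K ≤ A / x ^ 2 ∧ ∑ j, A / (x + Δ j) ^ 2 = τ := by
  have hK : (1 : ℝ) ≤ K := by exact_mod_cast (Nat.lt_of_le_of_lt (Nat.zero_le _) b.isLt)
  set l := √(A / τ)
  set u := √(K * A / τ)
  have hl : 0 < l := Real.sqrt_pos.2 (by positivity)
  have hlu : l ≤ u := Real.sqrt_le_sqrt (by gcongr; nlinarith)
  have hl2 : A / l ^ 2 = τ := by rw [Real.sq_sqrt (by positivity)]; field_simp
  have hu2 : A / u ^ 2 = τ / K := by rw [Real.sq_sqrt (by positivity)]; field_simp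
  have hcont : ContinuousOn (fun x => ∑ j, A / (x + Δ j) ^ 2) (Set.Icc l u) := by
    refine continuousOn_finsetSum _ fun j _ => ?_
    refine ContinuousOn.div (by fun_prop) (by fun_prop) fun x hx => ?_
    have := hl.trans_le hx.1
    have := hΔ j
    positivity
  have hmem : τ ∈ Set.Icc (∑ j, A / (u + Δ j) ^ 2) (∑ j, A / (l + Δ j) ^ 2) := by
    constructor
    · calc ∑ j, A / (u + Δ j) ^ 2 ≤ ∑ _j : Fin K, τ / K := by
            refine Finset.sum_le_sum fun j _ => ?_
            rw [← hu2]
            have := hl.trans_le hlu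
            gcongr
            linarith [hΔ j]
        _ = τ := by simp; field_simp
    · calc τ = A / (l + Δ b) ^ 2 := by rw [hb, add_zero, hl2]
        _ ≤ _ := Finset.single_le_sum (f := fun j => A / (l + Δ j) ^ 2)
            (fun j _ => by positivity) (Finset.mem_univ b)
  obtain ⟨x, hx, hxe⟩ := intermediate_value_Icc' hlu hcont hmem
  have hx0 := hl.trans_le hx.1
  refine ⟨x, hx0, ?_, hxe⟩
  rw [← hu2]
  gcongr
  exact hx.2

/-- It suffices that `x' ≤ q x` with `q = F' / F`. Otherwise the best arm would lose pulls while
each other arm grows by a factor at most `q ^ 2`. As the others hold at most `τ - τ / K` pulls, `hq`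
would make the total grow by less than one. -/
lemma div_add_le_of_sum_eq (hΔ : ∀ j, 0 ≤ Δ j) (hb : Δ b = 0) {x x' F F' τ : ℝ} (hx : 0 < x)
    (hx' : 0 < x') (hF : 0 < F) (hFF' : F ≤ F') (hτ : 0 < τ)
    (hq : ((F' / F) ^ 2 - 1) * (K - 1) ≤ K / τ) (hbx : τ / K ≤ F ^ 2 / x ^ 2)
    (hsum : ∑ j, F ^ 2 / (x + Δ j) ^ 2 = τ) (hsum' : ∑ j, F' ^ 2 / (x' + Δ j) ^ 2 = τ + 1)
    (i : Fin K) : F / (x + Δ i) ≤ F' / (x' + Δ i) := by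
  have hK : (1 : ℝ) ≤ K := by exact_mod_cast (Nat.lt_of_le_of_lt (Nat.zero_le _) b.isLt)
  set q := F' / F
  have hq1 : 1 ≤ q := (one_le_div hF).2 hFF'
  have hF' : F' = q * F := by simp [q, hF.ne']
  have hxq : x' ≤ q * x := by
    by_contra! hlt
    have hxx' : x ≤ x' := by nlinarith
    have h1 : ∑ j ∈ Finset.univ.erase b, F' ^ 2 / (x' + Δ j) ^ 2 ≤
        q ^ 2 * ∑ j ∈ Finset.univ.erase b, F ^ 2 / (x + Δ j) ^ 2 := by
      rw [Finset.mul_sum]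
      refine Finset.sum_le_sum fun j _ => ?_
      rw [← mul_div_assoc, ← mul_pow, ← hF']
      have := hΔ j
      gcongr
    have h2 : F' ^ 2 / (x' + Δ b) ^ 2 < F ^ 2 / (x + Δ b) ^ 2 := by
      rw [hb, add_zero, add_zero, ← div_pow, ← div_pow]
      have hq0 : 0 < q := by linarith
      have : F' / x' < F / x := by
        rw [div_lt_div_iff₀ hx' hx, hF']
        nlinarith
      have h0 : 0 ≤ F' / x' := by rw [hF']; positivity
      gcongr
    rw [← Finset.add_sum_erase _ _ (Finset.mem_univ b)] at hsum hsum'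
    have h3 : ∑ j ∈ Finset.univ.erase b, F ^ 2 / (x + Δ j) ^ 2 = τ - F ^ 2 / (x + Δ b) ^ 2 := by
      linarith
    rw [h3] at h1
    simp only [hb, add_zero] at h1 h2 hsum hsum'
    have hq2 : 0 ≤ q ^ 2 - 1 := by nlinarith
    have h4 : (q ^ 2 - 1) * (τ / K) ≤ (q ^ 2 - 1) * (F ^ 2 / x ^ 2) := by gcongr
    have h5 : τ + 1 < τ + (q ^ 2 - 1) * (τ - τ / K) := by nlinarith
    have h6 : (q ^ 2 - 1) * (τ - τ / K) ≤ 1 := by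
      have : (q ^ 2 - 1) * (τ - τ / K) = (q ^ 2 - 1) * (K - 1) * (τ / K) := by field_simp
      rw [this]
      calc _ ≤ K / τ * (τ / K) := by gcongr
        _ = 1 := by field_simp
    linarith
  have hi := hΔ i
  rw [div_le_div_iff₀ (by positivity) (by positivity), hF']
  have : x' + Δ i ≤ q * (x + Δ i) := by nlinarith
  nlinarith

/-- Existence of the noiseless allocation: the indices are equal in every round `τ ≥ s`, and no
arm loses pulls from one round to the next. -/
lemma exists_fluid (b : Fin K) (mean : Fin K → ℝ) (f : ℕ → ℝ) {s : ℕ} (hs : 0 < s)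
    (hbest : ∀ j, mean j ≤ mean b) (hf : ∀ τ, s ≤ τ → 0 < f τ)
    (hff : ∀ τ, s ≤ τ → f τ ≤ f (τ + 1))
    (hq : ∀ τ, s ≤ τ → ((f (τ + 1) / f τ) ^ 2 - 1) * (K - 1) ≤ K / (τ : ℝ)) :
    ∃ n : ℕ → Fin K → ℝ, (∀ τ, s ≤ τ → ∀ j, 0 < n τ j) ∧
      (∀ τ, s ≤ τ → ∃ lam, ∀ j, mean j + f τ / √(n τ j) = lam) ∧
      (∀ τ, s ≤ τ → ∑ j, n τ j = τ) ∧ (∀ τ, s ≤ τ → ∀ j, n τ j ≤ n (τ + 1) j) := by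
  set Δ : Fin K → ℝ := fun j => mean b - mean j
  have hΔ : ∀ j, 0 ≤ Δ j := fun j => sub_nonneg.2 (hbest j)
  have hb : Δ b = 0 := sub_self _
  have hex : ∀ τ : ℕ, ∃ x : ℝ, s ≤ τ → 0 < x ∧ (τ : ℝ) / K ≤ f τ ^ 2 / x ^ 2 ∧
      ∑ j, f τ ^ 2 / (x + Δ j) ^ 2 = τ := by
    intro τ
    by_cases hτ : s ≤ τ
    · have hτ0 : (0 : ℝ) < τ := by exact_mod_cast hs.trans_le hτ
      obtain ⟨x, hx⟩ := exists_sum_div_sq_eq hΔ hb (pow_pos (hf τ hτ) 2) hτ0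
      exact ⟨x, fun _ => hx⟩
    · exact ⟨0, fun h => absurd h hτ⟩
  choose x hx using hex
  have hpos : ∀ τ, s ≤ τ → ∀ j, 0 < x τ + Δ j := fun τ hτ j => by
    have := (hx τ hτ).1
    have := hΔ j
    positivity
  refine ⟨fun τ j => (f τ / (x τ + Δ j)) ^ 2, fun τ hτ j => ?_, fun τ hτ => ⟨mean b + x τ, ?_⟩,
    fun τ hτ => ?_, fun τ hτ j => ?_⟩
  · exact pow_pos (div_pos (hf τ hτ) (hpos τ hτ j)) 2
  · intro j
    have h1 := hf τ hτ
    have h2 := hpos τ hτ j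
    rw [Real.sqrt_sq (by positivity), div_div_cancel₀ h1.ne']
    simp only [Δ]; ring
  · simp only [div_pow]
    exact (hx τ hτ).2.2
  · have hτ' : s ≤ τ + 1 := hτ.trans (Nat.le_succ τ)
    have h1 := hf τ hτ
    have h2 := hpos τ hτ j
    have h3 := div_add_le_of_sum_eq hΔ hb (hx τ hτ).1 (hx (τ + 1) hτ').1 h1 (hff τ hτ)
      (by exact_mod_cast hs.trans_le hτ) (hq τ hτ) (hx τ hτ).2.1 (hx τ hτ).2.2
      (by exact_mod_cast (hx (τ + 1) hτ').2.2) j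
    exact pow_le_pow_left₀ (div_pos h1 h2).le h3 2

end Fluid

/-! ### From the algorithm's histories to UCB paths -/

section Bridge

variable {K T : ℕ} {act : ℕ → Fin K}

lemma pulls_eq_count {n : ℕ} {b : Fin n → Fin K} (h : ∀ s : Fin n, act s = b s) (i : Fin K) :
    pulls b i = count act i n := by
  simp only [pulls, count, Finset.card_filter, Finset.sum_range, h]

lemma exists_extension (hK : 0 < K) (a : Fin T → Fin K) :
    ∃ act : ℕ → Fin K, ∀ s : Fin T, act s = a s :=
  ⟨fun t => if h : t < T then a ⟨t, h⟩ else ⟨0, hK⟩, fun s => by simp⟩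

/-- Successive pulls of an arm consume its row in order, so empirical means are those of initial
segments of the row, whatever the order of play. -/
lemma sum_collected_eq (x : Fin K × ℕ → ℝ) (act : ℕ → Fin K) (i : Fin K) (t : ℕ) :
    ∑ s ∈ Finset.range t, (if act s = i then x (act s, count act (act s) s) else 0) =
      ∑ k ∈ Finset.range (count act i t), x (i, k) := by
  induction t with
  | zero => simp [count_zero]
  | succ t ih =>
    rw [Finset.sum_range_succ, ih, count_succ]
    by_cases h : act t = i
    · subst h
      simp [Finset.sum_range_succ]
    · simp [h]

/-- The mean of the first `n` rewards of arm `i` in the table `x`. -/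
noncomputable def tableMean (x : Fin K × ℕ → ℝ) (i : Fin K) (n : ℕ) : ℝ :=
  (∑ k ∈ Finset.range n, x (i, k)) / n

lemma pulls_prefixOf {a : Fin T → Fin K} (h : ∀ s : Fin T, act s = a s) (t : Fin T) (i : Fin K) :
    pulls (prefixOf a t) i = count act i t :=
  pulls_eq_count (fun s => h ⟨s, s.isLt.trans t.isLt⟩) i

lemma count_observed {a : Fin T → Fin K} (h : ∀ s : Fin T, act s = a s) (x : Fin K × ℕ → ℝ)
    (t : Fin T) (i : Fin K) : (observed x a t).count i = count act i t :=
  pulls_prefixOf h t i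

lemma empMean_observed {a : Fin T → Fin K} (h : ∀ s : Fin T, act s = a s) (x : Fin K × ℕ → ℝ)
    (t : Fin T) (i : Fin K) :
    (observed x a t).empMean i = tableMean x i (count act i t) := by
  rw [History.empMean, count_observed h, tableMean, ← sum_collected_eq, Finset.sum_range]
  congr 1
  refine Finset.sum_congr rfl fun s _ => ?_
  have hs : act s = a ⟨s, s.isLt.trans t.isLt⟩ := h ⟨s, s.isLt.trans t.isLt⟩
  simp only [observed, prefixOf, collected, hs, pulls_prefixOf h]

lemma IsUCB.isUCBPath {f : ℕ → ℝ} {alg : Algorithm} (halg : IsUCB f alg) (hK : 0 < K)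
    {x : Fin K × ℕ → ℝ} {a : Fin T → Fin K} (ha : pathWeight alg T x a ≠ 0)
    (h : ∀ s : Fin T, act s = a s) : IsUCBPath f (tableMean x) act T where
  init t ht htK := by
    have := mem_of_pathWeight_ne_zero hK ha ⟨t, ht⟩ ((halg K T t hK (observed x a ⟨t, ht⟩)).1 htK)
    rw [Set.mem_ofPred_eq, count_observed h, ← h ⟨t, ht⟩] at this
    exact this
  argmax t ht htK j := by
    have := mem_of_pathWeight_ne_zero hK ha ⟨t, ht⟩
      ((halg K T t hK (observed x a ⟨t, ht⟩)).2 htK) j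
    simp only [ucbIndex, count_observed h, empMean_observed h, ← h ⟨t, ht⟩] at this
    exact this

end Bridge

/-! ### Uniform concentration of empirical means -/

section Concentration

variable {ν : Instance} {c : ℝ≥0}

lemma measurable_tableMean {K : ℕ} (i : Fin K) (n : ℕ) : Measurable (fun x => tableMean x i n) := by
  unfold tableMean
  fun_prop

/-- The threshold scales as `√n`, so the sub-Gaussian tail does not depend on `n`; the sign `u`
treats both tails at once. -/
lemma measureReal_le_sum_row (hν : ∀ i, HasSubgaussianMGF (fun x => x - ν.mean i) c
    (ν.law i : Measure ℝ)) (i : Fin ν.numArms) {g : ℝ} (hg : 0 ≤ g) (n : ℕ) (hn : 0 < n) (u : ℝ)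
    (hu : u = 1 ∨ u = -1) :
    (tableLaw ν).real {x | g * √(n : ℝ) ≤ ∑ k ∈ Finset.range n, u * (x (i, k) - ν.mean i)} ≤
      Real.exp (-g ^ 2 / (2 * c)) := by
  have hind : iIndepFun (fun (k : ℕ) (x : Fin ν.numArms × ℕ → ℝ) => u * (x (i, k) - ν.mean i))
      (tableLaw ν) := by
    have h := iIndepFun_infinitePi (P := fun p : Fin ν.numArms × ℕ => (ν.law p.1 : Measure ℝ))
      (X := fun _ y => u * (y - ν.mean i)) (by fun_prop)
    exact h.precomp (g := fun k : ℕ => (i, k)) (Prod.mk_right_injective i)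
  have hsub : ∀ k < n, HasSubgaussianMGF
      (fun x : Fin ν.numArms × ℕ → ℝ => u * (x (i, k) - ν.mean i)) c (tableLaw ν) := by
    intro k _
    have hmap : (tableLaw ν).map (fun x => x (i, k)) = (ν.law i : Measure ℝ) :=
      Measure.infinitePi_map_eval (fun p : Fin ν.numArms × ℕ => (ν.law p.1 : Measure ℝ)) (i, k)
    have h1 : HasSubgaussianMGF (fun y => y - ν.mean i) c
        ((tableLaw ν).map (fun x => x (i, k))) := hmap ▸ hν i
    have h2 : HasSubgaussianMGF (fun x : Fin ν.numArms × ℕ → ℝ => x (i, k) - ν.mean i) c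
        (tableLaw ν) :=
      HasSubgaussianMGF.of_map (X := fun y => y - ν.mean i)
        (measurable_pi_apply (i, k)).aemeasurable h1
    rcases hu with rfl | rfl
    · simpa using h2
    · exact h2.neg.congr (ae_of_all _ fun x => by simp)
  refine (HasSubgaussianMGF.measure_sum_range_ge_le_of_iIndepFun hind hsub
    (by positivity)).trans_eq ?_
  congr 1
  have : (0 : ℝ) < n := by exact_mod_cast hn
  rw [mul_pow, Real.sq_sqrt this.le]
  field_simp

/-- The reward tables for which some empirical mean of at most `T` rewards is far from its
expectation. -/
def deviationSet (ν : Instance) (g : ℝ) (T : ℕ) : Set (Fin ν.numArms × ℕ → ℝ) :=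
  ⋃ i, ⋃ n ∈ Finset.Icc 1 T, {x | g / √(n : ℝ) < |tableMean x i n - ν.mean i|}

lemma measurableSet_deviationSet (ν : Instance) (g : ℝ) (T : ℕ) :
    MeasurableSet (deviationSet ν g T) :=
  MeasurableSet.iUnion fun i => Finset.measurableSet_biUnion _ fun n _ =>
    measurableSet_lt measurable_const ((measurable_tableMean i n).sub_const _).abs

lemma abs_tableMean_sub_le {g : ℝ} {T : ℕ} {x : Fin ν.numArms × ℕ → ℝ}
    (hx : x ∉ deviationSet ν g T) (i : Fin ν.numArms) (n : ℕ) (h1 : 1 ≤ n) (hT : n ≤ T) :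
    |tableMean x i n - ν.mean i| ≤ g / √(n : ℝ) := by
  by_contra! h
  exact hx (Set.mem_iUnion.2 ⟨i, Set.mem_iUnion₂.2 ⟨n, Finset.mem_Icc.2 ⟨h1, hT⟩, h⟩⟩)

lemma measureReal_deviationSet_le (hν : ∀ i, HasSubgaussianMGF (fun x => x - ν.mean i) c
    (ν.law i : Measure ℝ)) {g : ℝ} (hg : 0 ≤ g) (T : ℕ) :
    (tableLaw ν).real (deviationSet ν g T) ≤
      ν.numArms * (T * (2 * Real.exp (-g ^ 2 / (2 * c)))) := by
  have hone : ∀ i : Fin ν.numArms, ∀ n ∈ Finset.Icc 1 T,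
      (tableLaw ν).real {x | g / √(n : ℝ) < |tableMean x i n - ν.mean i|} ≤
        2 * Real.exp (-g ^ 2 / (2 * c)) := by
    intro i n hn
    have hn0 : 0 < n := (Finset.mem_Icc.1 hn).1
    have hnR : (0 : ℝ) < n := by exact_mod_cast hn0
    have hsub : {x : Fin ν.numArms × ℕ → ℝ | g / √(n : ℝ) < |tableMean x i n - ν.mean i|} ⊆
        {x | g * √(n : ℝ) ≤ ∑ k ∈ Finset.range n, 1 * (x (i, k) - ν.mean i)} ∪
        {x | g * √(n : ℝ) ≤ ∑ k ∈ Finset.range n, (-1) * (x (i, k) - ν.mean i)} := by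
      intro x hx
      have hx' : g / √(n : ℝ) < |tableMean x i n - ν.mean i| := hx
      have hs : ∑ k ∈ Finset.range n, (x (i, k) - ν.mean i) =
          n * (tableMean x i n - ν.mean i) := by
        rw [tableMean, Finset.sum_sub_distrib]
        simp
        field_simp
      have hgn : g * √(n : ℝ) = n * (g / √(n : ℝ)) := by
        have := Real.mul_self_sqrt hnR.le
        have := Real.sqrt_pos.2 hnR
        field_simp
        rw [Real.sq_sqrt hnR.le]
      simp only [Set.mem_union, Set.mem_ofPred_eq, ← Finset.mul_sum, hs, hgn]
      rcases lt_abs.1 hx' with h | h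
      · left; nlinarith
      · right; nlinarith
    calc _ ≤ _ := measureReal_mono hsub
      _ ≤ _ := measureReal_union_le _ _
      _ ≤ _ := by
        have h1 := measureReal_le_sum_row hν i hg n hn0 1 (Or.inl rfl)
        have h2 := measureReal_le_sum_row hν i hg n hn0 (-1) (Or.inr rfl)
        linarith
  unfold deviationSet
  calc _ ≤ ∑ i : Fin ν.numArms, (tableLaw ν).real
          (⋃ n ∈ Finset.Icc 1 T, {x | g / √(n : ℝ) < |tableMean x i n - ν.mean i|}) :=
        measureReal_iUnion_fintype_le _
    _ ≤ ∑ _i : Fin ν.numArms, (T : ℝ) * (2 * Real.exp (-g ^ 2 / (2 * c))) := by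
        refine Finset.sum_le_sum fun i _ => ?_
        refine (measureReal_biUnion_finset_le _ _).trans ?_
        refine (Finset.sum_le_card_nsmul _ _ _ (hone i)).trans_eq ?_
        simp
    _ = _ := by simp

end Concentration

/-! ### Regret and variability for a general exploration function -/

section UCB

variable {ν : Instance} {f : ℕ → ℝ} {alg : Algorithm} {g : ℝ} {T s : ℕ}

lemma Instance.mean_le_iSup (ν : Instance) (i : Fin ν.numArms) : ν.mean i ≤ ⨆ j, ν.mean j :=
  le_ciSup (Set.finite_range _).bddAbove i

lemma Instance.gap_nonneg (ν : Instance) (i : Fin ν.numArms) : 0 ≤ ν.gap i :=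
  sub_nonneg.2 (ν.mean_le_iSup i)

lemma Instance.exists_best (ν : Instance) (hK : 0 < ν.numArms) :
    ∃ b, (⨆ j, ν.mean j) = ν.mean b := by
  have : Nonempty (Fin ν.numArms) := ⟨⟨0, hK⟩⟩
  obtain ⟨b, hb⟩ := exists_eq_ciSup_of_finite (f := ν.mean)
  exact ⟨b, hb.symm⟩

lemma pulls_le {K T : ℕ} (a : Fin T → Fin K) (i : Fin K) : (pulls a i : ℝ) ≤ T := by
  have : pulls a i ≤ T := (Finset.card_filter_le _ _).trans (by simp)
  exact_mod_cast this

lemma IsUCB.regret_le (halg : IsUCB f alg) (hK : 0 < ν.numArms) {F G : ℝ}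
    (hF : ∀ t ≤ T, f t ≤ F) (hF0 : 0 ≤ F) (hg : ∀ t, s ≤ t → g ≤ f (t + 1))
    (hG : ∀ i, ν.gap i ≤ G) :
    regret alg ν T ≤ ν.numArms *
      (2 * F * √(T : ℝ) + G * (s + 1) + G * T * (tableLaw ν).real (deviationSet ν g T)) := by
  obtain ⟨b, hb⟩ := ν.exists_best hK
  have hG0 : 0 ≤ G := (ν.gap_nonneg b).trans (hG b)
  have hone : ∀ i, ν.gap i * ∫ a, (pulls a i : ℝ) ∂actionLaw alg ν T ≤
      2 * F * √(T : ℝ) + G * (s + 1) + G * T * (tableLaw ν).real (deviationSet ν g T) := by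
    intro i
    have hgap : ν.gap i = ν.mean b - ν.mean i := by rw [Instance.gap, hb]
    rw [← integral_const_mul]
    refine integral_actionLaw_le alg hK _ (measurableSet_deviationSet ν g T) ?_ ?_
    · intro x hx a ha
      obtain ⟨act, hact⟩ := exists_extension hK a
      have h := (halg.isUCBPath hK ha hact).gap_mul_le (μ := ν.mean)
        (fun i n h1 h2 => abs_tableMean_sub_le hx i n h1 h2) hF hF0 hg i b
        (hb ▸ ν.mean_le_iSup i)
      rw [pulls_eq_count hact, hgap]
      have h1 : (ν.mean b - ν.mean i) * (s + 1) ≤ G * (s + 1) := by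
        rw [← hgap]; gcongr; exact hG i
      nlinarith
    · intro a
      have h1 : ν.gap i * pulls a i ≤ G * T :=
        mul_le_mul (hG i) (pulls_le a i) (Nat.cast_nonneg _) hG0
      have h2 : 0 ≤ 2 * F * √(T : ℝ) + G * (s + 1) := by positivity
      linarith
  unfold regret
  refine (Finset.sum_le_card_nsmul _ _ _ fun i _ => hone i).trans_eq ?_
  rw [Finset.card_univ, Fintype.card_fin, nsmul_eq_mul]

lemma IsUCB.variability_le (halg : IsUCB f alg) (hK : 0 < ν.numArms) (hg : 0 ≤ g)
    (hKs : ν.numArms ≤ s) (hsT : s ≤ T) (hgf : ∀ τ, s ≤ τ → g < f τ)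
    (hff : ∀ τ, s ≤ τ → f τ ≤ f (τ + 1))
    (hq : ∀ τ, s ≤ τ → ((f (τ + 1) / f τ) ^ 2 - 1) * (ν.numArms - 1) ≤ ν.numArms / (τ : ℝ))
    {D : ℝ} (hsD : s ≤ D)
    (hD : ∀ τ, s ≤ τ → τ ≤ T → 3 * ν.numArms * (g / f τ) * τ + 1 ≤ D) :
    variability alg ν T ≤
      √((ν.numArms * D) ^ 2 + T ^ 2 * (tableLaw ν).real (deviationSet ν g T)) := by
  obtain ⟨b, hb⟩ := ν.exists_best hK
  obtain ⟨n, hn, hlam, hsum, hmono⟩ := exists_fluid b ν.mean f (hK.trans_le hKs)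
    (fun j => hb ▸ ν.mean_le_iSup j) (fun τ hτ => hg.trans_lt (hgf τ hτ)) hff hq
  have : Nonempty (Fin ν.numArms) := ⟨⟨0, hK⟩⟩
  have := isProbabilityMeasure_actionLaw (T := T) alg hK
  refine ciSup_le fun i => Real.sqrt_le_sqrt ?_
  -- The fluid allocation is deterministic, so it may serve as the centre: the variance is at most
  -- the mean squared distance to it.
  rw [← variance_sub_const (measurable_of_finite _).aestronglyMeasurable (n T i)]
  refine (variance_le_expectation_sq (measurable_of_finite _).aestronglyMeasurable).trans ?_
  refine integral_actionLaw_le alg hK _ (measurableSet_deviationSet ν g T) ?_ ?_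
  · intro x hx a ha
    obtain ⟨act, hact⟩ := exists_extension hK a
    have h := (halg.isUCBPath hK ha hact).abs_count_sub_le (μ := ν.mean)
      (fun i n h1 h2 => abs_tableMean_sub_le hx i n h1 h2) hg hKs hsT hgf hn hlam hsum hmono
      hsD hD i
    rw [Pi.pow_apply, pulls_eq_count hact]
    exact sq_le_sq' (neg_le_of_abs_le h) (le_of_abs_le h)
  · intro a
    have h0 := (hn T hsT i).le
    have h1 : n T i ≤ T := (Finset.single_le_sum (fun k _ => (hn T hsT k).le)
      (Finset.mem_univ i)).trans_eq (hsum T hsT)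
    have h2 := pulls_le a i
    have h3 : (0 : ℝ) ≤ pulls a i := Nat.cast_nonneg _
    have h4 : ((pulls a i : ℝ) - n T i) ^ 2 ≤ (T : ℝ) ^ 2 :=
      sq_le_sq' (by linarith) (by linarith)
    have h5 := sq_nonneg (ν.numArms * D)
    simpa using h4.trans (le_add_of_nonneg_left h5)

end UCB

/-- The exploration function `t ^ β * log t`. -/
noncomputable def explore (β : ℝ) (t : ℕ) : ℝ := (t : ℝ) ^ β * Real.log t

/-! ### Growth of the exploration function -/

section Explore

variable {β : ℝ} {t τ : ℕ}

lemma explore_mono (hβ : 0 ≤ β) (ht : t ≤ τ) : explore β t ≤ explore β τ := by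
  rcases Nat.eq_zero_or_pos t with rfl | h0
  · simpa [explore] using mul_nonneg (Real.rpow_nonneg (Nat.cast_nonneg τ) β)
      (Real.log_natCast_nonneg τ)
  · have h1 : (t : ℝ) ≤ τ := by exact_mod_cast ht
    have h2 : (0 : ℝ) < t := by exact_mod_cast h0
    have h3 : 0 ≤ Real.log t := Real.log_natCast_nonneg t
    unfold explore
    gcongr

lemma log_le_explore (hβ : 0 ≤ β) (hτ : 0 < τ) : Real.log τ ≤ explore β τ := by
  have h1 : (1 : ℝ) ≤ τ := by exact_mod_cast hτ
  exact le_mul_of_one_le_left (Real.log_natCast_nonneg τ) (Real.one_le_rpow h1 hβ)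

/-- This provides the monotonicity condition of `exists_fluid`. For `β ≤ 1/2` the power contributes
at most `1 + 1/τ` to the squared ratio. The logarithm adds at most `1 / (Kτ)` once `log τ ≥ 6K`, and
`(1 + 1/K)(K - 1) ≤ K`. -/
lemma explore_ratio (hβ' : β ≤ 1 / 2) {K : ℝ} (hK : 1 ≤ K) (hτ : 0 < τ)
    (hlog : 6 * K ≤ Real.log τ) :
    ((explore β (τ + 1) / explore β τ) ^ 2 - 1) * (K - 1) ≤ K / (τ : ℝ) := by
  have hτ1 : (1 : ℝ) ≤ τ := by exact_mod_cast hτ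
  have hτ0 : (0 : ℝ) < τ := by linarith
  set L := Real.log τ
  have hL : 0 < L := by linarith
  set r : ℝ := 1 + 1 / τ
  have hr : 1 ≤ r := by simp [r]
  have hτr : ((τ + 1 : ℕ) : ℝ) = r * τ := by simp only [r]; push_cast; field_simp
  set l := Real.log (τ + 1 : ℕ) / L
  have hl0 : 0 ≤ l := div_nonneg (Real.log_natCast_nonneg _) hL.le
  have hl : l ≤ 1 + 1 / (τ * L) := by
    have h1 : Real.log (τ + 1 : ℕ) ≤ 1 / τ + L := by
      rw [hτr, Real.log_mul (by linarith) hτ0.ne']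
      have := Real.log_le_sub_one_of_pos (by linarith : 0 < r)
      simp only [r] at this ⊢
      linarith
    simp only [l]
    rw [div_le_iff₀ hL]
    calc _ ≤ _ := h1
      _ = _ := by field_simp; ring
  have hq : explore β (τ + 1) / explore β τ = r ^ β * l := by
    have : (τ : ℝ) ^ β ≠ 0 := (Real.rpow_pos_of_pos hτ0 β).ne'
    have hL' : Real.log τ ≠ 0 := hL.ne'
    simp only [explore, hτr, l, L]
    rw [Real.mul_rpow (by linarith) hτ0.le]
    field_simp
  have hrβ : (r ^ β) ^ 2 ≤ r := by
    rw [← Real.rpow_natCast, ← Real.rpow_mul (by linarith)]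
    calc r ^ (β * (2 : ℕ)) ≤ r ^ (1 : ℝ) :=
          Real.rpow_le_rpow_of_exponent_le hr (by push_cast; linarith)
      _ = r := Real.rpow_one r
  set w := 1 / (τ * L)
  have hw : 0 ≤ w := by positivity
  have hw1 : w ≤ 1 := by
    simp only [w]
    rw [div_le_one (by positivity)]
    nlinarith
  have hwK : 6 * K * w ≤ 1 / τ := by
    simp only [w]
    rw [mul_one_div, div_le_div_iff₀ (by positivity) hτ0]
    nlinarith
  have hr2 : r ≤ 2 := by
    simp only [r]
    have : (1 : ℝ) / τ ≤ 1 := by rw [div_le_one hτ0]; exact hτ1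
    linarith
  have hq2 : (r ^ β * l) ^ 2 ≤ 1 + 1 / τ + 6 * w := by
    rw [mul_pow]
    calc (r ^ β) ^ 2 * l ^ 2 ≤ r * (1 + w) ^ 2 := by gcongr
      _ ≤ r * (1 + 3 * w) := by
        gcongr
        nlinarith
      _ ≤ 1 + 1 / τ + 6 * w := by
        have : r * w ≤ 2 * w := by gcongr
        simp only [r] at this ⊢
        nlinarith
  rw [hq]
  have h1 : ((r ^ β * l) ^ 2 - 1) * (K - 1) ≤ (1 / τ + 6 * w) * (K - 1) := by
    apply mul_le_mul_of_nonneg_right <;> linarith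
  have h2 : K / (τ : ℝ) = K * (1 / τ) := by ring
  rw [h2]
  nlinarith

lemma div_explore_le {T : ℕ} (hβ : β ≤ 1) (hτ : 0 < τ) (hτT : τ ≤ T)
    (hlog : Real.log T / 2 ≤ Real.log τ) (hT : 0 < Real.log T) :
    (τ : ℝ) / explore β τ ≤ 2 * (T : ℝ) ^ (1 - β) / Real.log T := by
  have hτ0 : (0 : ℝ) < τ := by exact_mod_cast hτ
  have hτT' : (τ : ℝ) ≤ T := by exact_mod_cast hτT
  have h1 : (τ : ℝ) = τ ^ (1 - β) * τ ^ β := by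
    rw [← Real.rpow_add hτ0]; simp
  have h2 : (τ : ℝ) / explore β τ = τ ^ (1 - β) / Real.log τ := by
    have : (τ : ℝ) ^ β ≠ 0 := (Real.rpow_pos_of_pos hτ0 β).ne'
    unfold explore
    nth_rewrite 1 [h1]
    field_simp
  rw [h2]
  calc (τ : ℝ) ^ (1 - β) / Real.log τ ≤ (T : ℝ) ^ (1 - β) / (Real.log T / 2) := by
        have : 0 ≤ 1 - β := by linarith
        gcongr
    _ = _ := by field_simp

end Explore

/-! ### Rates for UCB with polynomial exploration -/

section UCB

variable {M σ β : ℝ} {Kbar : ℕ}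

lemma gap_le_of_mem {ν : Instance} (hν : ν ∈ subGaussianClass M σ Kbar) (i : Fin ν.numArms) :
    ν.gap i ≤ 2 * M := by
  have : Nonempty (Fin ν.numArms) := ⟨i⟩
  have h1 : (⨆ j, ν.mean j) ≤ M := ciSup_le fun j => (hν.2.2 j).1.2
  have h2 := (hν.2.2 i).1.1
  unfold Instance.gap
  linarith

/-- Regret and variability of UCB with exploration `t ^ β * log t`, uniformly over the class. -/
theorem ucb_bounds (hM : 0 < M) (hσ : 0 < σ) (hβ : 0 ≤ β) (hβ' : β ≤ 1 / 2) :
    ∃ C : ℝ, 0 < C ∧ ∀ᶠ T : ℕ in atTop, ∀ alg, IsUCB (explore β) alg →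
      ∀ ν ∈ subGaussianClass M σ Kbar,
        regret alg ν T ≤ C * ((T : ℝ) ^ (β + 1 / 2) * Real.log T) ∧
        variability alg ν T ≤ C * (T : ℝ) ^ (1 - β) := by
  set C₁ : ℝ := Kbar * (2 + 6 * M + 4 * M * Kbar)
  set C₂ : ℝ := Kbar * (3 + 18 * Kbar * σ) + 2 * Kbar
  have hC₁ : 0 ≤ C₁ := by positivity
  have hC₂ : 0 ≤ C₂ := by positivity
  refine ⟨C₁ + C₂ + 1, by positivity, ?_⟩
  have hlog : ∀ a : ℝ, ∀ᶠ T : ℕ in atTop, a ≤ Real.log T := fun a =>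
    (Real.tendsto_log_atTop.comp tendsto_natCast_atTop_atTop).eventually_ge_atTop a
  filter_upwards [eventually_ge_atTop 1, eventually_ge_atTop (Kbar ^ 2), hlog 1,
    hlog (12 * Kbar), hlog (32 * σ ^ 2 + 1)] with T hT1 hTK hl1 hlK hlσ
  intro alg halg ν hν
  obtain ⟨hK2, hKK, hlaw⟩ := id hν
  have hK : 0 < ν.numArms := by omega
  have hTR : (1 : ℝ) ≤ T := by exact_mod_cast hT1
  have hT0 : (0 : ℝ) < T := by linarith
  have hK1 : (1 : ℝ) ≤ ν.numArms := by exact_mod_cast hK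
  have hKb : (ν.numArms : ℝ) ≤ Kbar := by exact_mod_cast hKK
  set k : ℝ := (ν.numArms : ℝ)
  set l := Real.log T
  have hl0 : 0 < l := by linarith
  -- From round `√T` on, `log τ ≥ (log T) / 2`, so the bonus dominates the noise; the discarded
  -- start, of order `√T`, is negligible against both target rates because `0 ≤ β ≤ 1/2`.
  set s := ⌈√(T : ℝ)⌉₊
  have hsq : √(T : ℝ) ≤ s := Nat.le_ceil _
  have hsq1 : (s : ℝ) ≤ √(T : ℝ) + 1 := (Nat.ceil_lt_add_one (Real.sqrt_nonneg _)).le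
  have hsqT : 1 ≤ √(T : ℝ) := Real.one_le_sqrt.2 hTR
  have hsT : s ≤ T := Nat.ceil_le.2 (Real.sqrt_le_iff.2 ⟨hT0.le, by nlinarith⟩)
  have hKs : ν.numArms ≤ s := by
    have h1 : (Kbar : ℝ) ≤ √(T : ℝ) := by
      apply Real.le_sqrt_of_sq_le
      exact_mod_cast hTK
    exact Nat.cast_le.1 (hKb.trans (h1.trans hsq))
  have hs0 : 0 < s := hK.trans_le hKs
  have hlogτ : ∀ τ : ℕ, s ≤ τ → l / 2 ≤ Real.log τ := by
    intro τ hτ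
    rw [← Real.log_sqrt hT0.le]
    refine Real.log_le_log (by linarith) (hsq.trans ?_)
    exact_mod_cast hτ
  -- The constant `8` makes each tail `T⁻⁴`, hence the bad event of order `T⁻³`, small enough to
  -- absorb the factor `T ^ 2` in the variance.
  set g := √(8 * σ ^ 2 * l)
  have hg : 0 ≤ g := Real.sqrt_nonneg _
  have hg2 : g ^ 2 = 8 * σ ^ 2 * l := Real.sq_sqrt (by positivity)
  have hgl : g < l / 2 := by
    apply (Real.sqrt_lt' (by linarith)).2
    nlinarith
  have hgl' : g ≤ 3 * σ * l := by
    refine Real.sqrt_le_iff.2 ⟨by positivity, ?_⟩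
    nlinarith [mul_nonneg (sq_nonneg σ) hl0.le, mul_le_mul_of_nonneg_left hl1
      (mul_nonneg (sq_nonneg σ) hl0.le)]
  have hgf : ∀ τ, s ≤ τ → g < explore β τ := fun τ hτ =>
    hgl.trans_le ((hlogτ τ hτ).trans (log_le_explore hβ (hs0.trans_le hτ)))
  set P := (tableLaw ν).real (deviationSet ν g T)
  have hP0 : 0 ≤ P := measureReal_nonneg
  have hP : P ≤ 2 * Kbar / (T : ℝ) ^ 3 := by
    have h := measureReal_deviationSet_le (ν := ν) (fun i => (hlaw i).2) hg T
    have hexp : Real.exp (-g ^ 2 / (2 * (Real.toNNReal (σ ^ 2) : ℝ))) = ((T : ℝ) ^ 4)⁻¹ := by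
      rw [Real.coe_toNNReal _ (sq_nonneg σ), hg2]
      have : -(8 * σ ^ 2 * l) / (2 * σ ^ 2) = -((4 : ℕ) * l) := by
        push_cast; field_simp; ring
      rw [this, Real.exp_neg, Real.exp_nat_mul, Real.exp_log hT0]
    rw [hexp] at h
    refine h.trans ?_
    calc k * (T * (2 * ((T : ℝ) ^ 4)⁻¹)) = 2 * k / (T : ℝ) ^ 3 := by field_simp
      _ ≤ _ := by gcongr
  have hTP : T * P ≤ 2 * Kbar := by
    calc T * P ≤ T * (2 * Kbar / (T : ℝ) ^ 3) := by gcongr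
      _ = 2 * Kbar / (T : ℝ) ^ 2 := by field_simp
      _ ≤ 2 * Kbar := div_le_self (by positivity) (one_le_pow₀ hTR)
  have hTP2 : (T : ℝ) ^ 2 * P ≤ 2 * (Kbar : ℝ) := by
    calc (T : ℝ) ^ 2 * P ≤ (T : ℝ) ^ 2 * (2 * (Kbar : ℝ) / (T : ℝ) ^ 3) := by gcongr
      _ = 2 * (Kbar : ℝ) / (T : ℝ) := by field_simp
      _ ≤ 2 * Kbar := div_le_self (by positivity) hTR
  constructor
  · set Y := (T : ℝ) ^ (β + 1 / 2) * l
    have hYeq : (T : ℝ) ^ β * l * √(T : ℝ) = Y := by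
      simp only [Y]
      rw [Real.rpow_add hT0, Real.sqrt_eq_rpow]; ring
    have hYs : √(T : ℝ) ≤ Y := by
      rw [← hYeq]
      refine le_mul_of_one_le_left (Real.sqrt_nonneg _) ?_
      have := Real.one_le_rpow hTR hβ
      nlinarith
    have h := halg.regret_le (T := T) (s := s) (g := g) (G := 2 * M) hK
      (fun t ht => explore_mono hβ ht) (mul_nonneg (Real.rpow_nonneg hT0.le _) hl0.le)
      (fun t ht => (hgf (t + 1) (by omega)).le) (gap_le_of_mem hν)
    have h1 : 2 * explore β T * √(T : ℝ) = 2 * Y := by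
      rw [← hYeq]; simp only [explore, l]; ring
    rw [h1] at h
    refine h.trans ?_
    have h2 : 2 * M * T * P ≤ 2 * M * (2 * Kbar) := by
      rw [mul_assoc]; gcongr
    have h3 : 2 * M * ((s : ℝ) + 1) ≤ 2 * M * (3 * Y) := by
      gcongr; linarith
    have h4 : 2 * M * (2 * Kbar) ≤ 4 * M * Kbar * Y := by
      calc 2 * M * (2 * Kbar) = 4 * M * Kbar := by ring
        _ ≤ _ := le_mul_of_one_le_right (by positivity) (hsqT.trans hYs)
    calc k * (2 * Y + 2 * M * (s + 1) + 2 * M * T * P)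
        ≤ Kbar * (2 * Y + 2 * M * (s + 1) + 2 * M * T * P) := by gcongr
      _ ≤ Kbar * ((2 + 6 * M + 4 * M * Kbar) * Y) := by gcongr; linarith
      _ = C₁ * Y := by simp only [C₁]; ring
      _ ≤ (C₁ + C₂ + 1) * Y := by gcongr; linarith
  · set X := (T : ℝ) ^ (1 - β)
    have hXs : √(T : ℝ) ≤ X := by
      rw [Real.sqrt_eq_rpow]
      exact Real.rpow_le_rpow_of_exponent_le hTR (by linarith)
    set D : ℝ := (3 + 18 * Kbar * σ) * X
    have hX0 : 0 < X := by linarith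
    have hX1 : 1 ≤ X := hsqT.trans hXs
    have hpos : 0 ≤ 18 * Kbar * σ * X := by positivity
    have hD : D = 3 * X + 18 * Kbar * σ * X := by simp only [D]; ring
    have h := halg.variability_le (T := T) (s := s) (g := g) (D := D) hK hg hKs hsT hgf
      (fun τ _ => explore_mono hβ (Nat.le_succ τ))
      (fun τ hτ => explore_ratio hβ' hK1 (hs0.trans_le hτ)
        (by have := hlogτ τ hτ; linarith))
      (by linarith) ?_
    · refine h.trans ?_
      have hkD : k * D ≤ Kbar * D := by gcongr
      have hKb1 : (1 : ℝ) ≤ Kbar := hK1.trans hKb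
      calc √((k * D) ^ 2 + T ^ 2 * P) ≤ Kbar * D + 2 * Kbar * X := by
            refine Real.sqrt_le_iff.2 ⟨by positivity, ?_⟩
            have h1 : (k * D) ^ 2 ≤ (Kbar * D) ^ 2 := by gcongr
            have h2 : (0 : ℝ) ≤ Kbar * D * (2 * Kbar * X) := by positivity
            have h3 : (2 * Kbar : ℝ) ≤ 2 * Kbar * X :=
              le_mul_of_one_le_right (by positivity) hX1
            have h4 : 2 * Kbar * X ≤ (2 * Kbar * X) ^ 2 :=
              le_self_pow₀ (by linarith) two_ne_zero
            rw [add_sq]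
            linarith
        _ = C₂ * X := by simp only [C₂, D]; ring
        _ ≤ (C₁ + C₂ + 1) * X := by gcongr; linarith
    · intro τ hτ hτT
      have h1 := div_explore_le (by linarith : β ≤ 1) (hs0.trans_le hτ) hτT (hlogτ τ hτ) hl0
      have h2 : 3 * k * (g / explore β τ) * τ = 3 * k * g * (τ / explore β τ) := by ring
      rw [h2]
      have h3 : 3 * k * g * (τ / explore β τ) ≤ 3 * Kbar * (3 * σ * l) * (2 * X / l) := by
        gcongr
        exact div_nonneg (Nat.cast_nonneg _) (hg.trans (hgf τ hτ).le)
      have h4 : 3 * Kbar * (3 * σ * l) * (2 * X / l) = 18 * Kbar * σ * X := by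
        field_simp; ring
      linarith

end UCB

/-! ### Change of measure by the chi-square divergence -/

section ChiSquare

lemma sq_integral_mul_le {Ω : Type*} [MeasurableSpace Ω] {μ : Measure Ω} {f g : Ω → ℝ}
    (hf : MemLp f 2 μ) (hg : MemLp g 2 μ) :
    (∫ x, f x * g x ∂μ) ^ 2 ≤ (∫ x, f x ^ 2 ∂μ) * ∫ x, g x ^ 2 ∂μ := by
  have hfg : Integrable (fun x => f x * g x) μ := hf.integrable_mul hg
  have h : ∀ t : ℝ, 0 ≤ (∫ x, f x ^ 2 ∂μ) * (t * t) + (2 * ∫ x, f x * g x ∂μ) * t +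
      ∫ x, g x ^ 2 ∂μ := by
    intro t
    have : ∫ x, (t * f x + g x) ^ 2 ∂μ = (∫ x, f x ^ 2 ∂μ) * (t * t) +
        (2 * ∫ x, f x * g x ∂μ) * t + ∫ x, g x ^ 2 ∂μ := by
      have he : ∀ x, (t * f x + g x) ^ 2 = (t * t) * f x ^ 2 + (2 * t) * (f x * g x) + g x ^ 2 :=
        fun x => by ring
      simp_rw [he]
      have h1 : Integrable (fun x => (t * t) * f x ^ 2) μ := hf.integrable_sq.const_mul _
      have h2 : Integrable (fun x => (2 * t) * (f x * g x)) μ := hfg.const_mul _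
      have h3 : Integrable (fun x => (t * t) * f x ^ 2 + (2 * t) * (f x * g x)) μ := h1.add h2
      rw [integral_add h3 hg.integrable_sq, integral_add h1 h2, integral_const_mul,
        integral_const_mul]
      ring
    rw [← this]
    exact integral_nonneg fun x => sq_nonneg _
  have := discrim_le_zero h
  unfold discrim at this
  nlinarith

variable {ι : Type*} [Fintype ι] {X : ι → Type*} [∀ i, MeasurableSpace (X i)]
  {p q : ∀ i, Measure (X i)} [∀ i, IsProbabilityMeasure (p i)] [∀ i, IsProbabilityMeasure (q i)]

/-- Checked on rectangles, where the integral of the product factorizes by independence of the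
coordinates. -/
lemma pi_eq_withDensity {l : ∀ i, X i → ℝ≥0∞} (hl : ∀ i, Measurable (l i))
    (hq : ∀ i, q i = (p i).withDensity (l i)) :
    Measure.pi q = (Measure.pi p).withDensity (fun x => ∏ i, l i (x i)) := by
  refine Measure.pi_eq fun s hs => ?_
  rw [withDensity_apply _ (MeasurableSet.univ_pi hs),
    ← lintegral_indicator (MeasurableSet.univ_pi hs)]
  have hind : ∀ x : ∀ i, X i, (Set.univ.pi s).indicator (fun x => ∏ i, l i (x i)) x =
      ∏ i, (s i).indicator (l i) (x i) := by
    intro x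
    by_cases hx : x ∈ Set.univ.pi s
    · rw [Set.indicator_of_mem hx]
      exact Finset.prod_congr rfl fun i _ => (Set.indicator_of_mem (hx i (Set.mem_univ i)) _).symm
    · rw [Set.indicator_of_notMem hx]
      obtain ⟨i, hi⟩ : ∃ i, x i ∉ s i := by simpa using hx
      exact (Finset.prod_eq_zero (Finset.mem_univ i) (Set.indicator_of_notMem hi _)).symm
  simp_rw [hind]
  have hm : ∀ i, Measurable ((s i).indicator (l i)) := fun i => (hl i).indicator (hs i)
  rw [lintegral_prod_eq_prod_lintegral_of_indepFun Finset.univ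
    (fun i (x : ∀ i, X i) => (s i).indicator (l i) (x i))
    (iIndepFun_pi fun i => (hm i).aemeasurable) fun i => (hm i).comp (measurable_pi_apply i)]
  refine Finset.prod_congr rfl fun i _ => ?_
  rw [(measurePreserving_eval p i).lintegral_comp (hm i), lintegral_indicator (hs i), hq,
    withDensity_apply _ (hs i)]

/-- A change of measure between product measures, controlled by the chi-square divergence. -/
lemma sq_integral_pi_sub_le {l : ∀ i, X i → ℝ} {B : ℝ} (hl : ∀ i, Measurable (l i))
    (hl0 : ∀ i x, 0 ≤ l i x) (hlB : ∀ i x, l i x ≤ B)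
    (hq : ∀ i, q i = (p i).withDensity (fun x => ENNReal.ofReal (l i x)))
    {F : (∀ i, X i) → ℝ} (hF : MemLp F 2 (Measure.pi p)) (c : ℝ) :
    ((∫ x, F x ∂Measure.pi q) - ∫ x, F x ∂Measure.pi p) ^ 2 ≤
      (∫ x, (F x - c) ^ 2 ∂Measure.pi p) * ((∏ i, ∫ x, l i x ^ 2 ∂p i) - 1) := by
  set Z : (∀ i, X i) → ℝ := fun x => ∏ i, l i (x i)
  have hZm : Measurable Z := Finset.measurable_fun_prod _ fun i _ =>
    (hl i).comp (measurable_pi_apply i)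
  have hZ0 : ∀ x, 0 ≤ Z x := fun x => Finset.prod_nonneg fun i _ => hl0 i _
  have hZB : ∀ x, ‖Z x‖ ≤ ∏ _i : ι, B := fun x => by
    rw [Real.norm_of_nonneg (hZ0 x)]
    exact Finset.prod_le_prod (fun i _ => hl0 i _) fun i _ => hlB i _
  have hZL : MemLp Z 2 (Measure.pi p) :=
    MemLp.of_bound hZm.aestronglyMeasurable _ (ae_of_all _ hZB)
  have hqZ : Measure.pi q = (Measure.pi p).withDensity (fun x => ENNReal.ofReal (Z x)) := by
    rw [pi_eq_withDensity (fun i => (hl i).ennreal_ofReal) hq]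
    congr 1
    funext x
    exact (ENNReal.ofReal_prod_of_nonneg fun i _ => hl0 i _).symm
  have hint : ∀ G : (∀ i, X i) → ℝ, ∫ x, G x ∂Measure.pi q = ∫ x, Z x * G x ∂Measure.pi p := by
    intro G
    rw [hqZ, integral_withDensity_eq_integral_toReal_smul hZm.ennreal_ofReal (by simp)]
    simp [ENNReal.toReal_ofReal, hZ0]
  have hZ1 : ∫ x, Z x ∂Measure.pi p = 1 := by
    have := hint fun _ => 1
    simpa using this.symm
  have hZ2 : ∫ x, Z x ^ 2 ∂Measure.pi p = ∏ i, ∫ x, l i x ^ 2 ∂p i := by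
    rw [← integral_fintype_prod_eq_prod (fun i x => l i x ^ 2)]
    simp [Z, Finset.prod_pow]
  have hF1 : Integrable F (Measure.pi p) := hF.integrable (by norm_num)
  have hZi : Integrable Z (Measure.pi p) := hZL.integrable (by norm_num)
  have hZF : Integrable (fun x => Z x * F x) (Measure.pi p) := hZL.integrable_mul hF
  -- Since `Z - 1` has mean zero under `p`, any constant `c` may be subtracted from `F`;
  -- Cauchy–Schwarz then yields the bound.
  have hdiff : (∫ x, F x ∂Measure.pi q) - ∫ x, F x ∂Measure.pi p =
      ∫ x, (F x - c) * (Z x - 1) ∂Measure.pi p := by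
    have he : ∀ x, (F x - c) * (Z x - 1) = (Z x * F x - F x) - c * (Z x - 1) := fun x => by ring
    simp_rw [he]
    have h1 : Integrable (fun x => Z x * F x - F x) (Measure.pi p) := hZF.sub hF1
    have h2 : Integrable (fun x => c * (Z x - 1)) (Measure.pi p) :=
      (hZi.sub (integrable_const 1)).const_mul c
    rw [integral_sub h1 h2, integral_sub hZF hF1, integral_const_mul,
      integral_sub hZi (integrable_const 1), hZ1, hint]
    simp
  have hvar : ∫ x, (Z x - 1) ^ 2 ∂Measure.pi p = (∏ i, ∫ x, l i x ^ 2 ∂p i) - 1 := by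
    have he : ∀ x, (Z x - 1) ^ 2 = Z x ^ 2 - (2 * Z x - 1) := fun x => by ring
    simp_rw [he]
    have h1 : Integrable (fun x => 2 * Z x - 1) (Measure.pi p) :=
      (hZi.const_mul 2).sub (integrable_const 1)
    rw [integral_sub hZL.integrable_sq h1, integral_sub (hZi.const_mul 2) (integrable_const 1),
      integral_const_mul, hZ1, hZ2]
    simp
    ring
  rw [hdiff, ← hvar]
  exact sq_integral_mul_le (hF.sub (memLp_const c)) (hZL.sub (memLp_const 1))

end ChiSquare

/-! ### Change of measure for bandit algorithms -/

section Transfer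

variable {K T : ℕ}

/-- Change of measure between two reward tables with `K` arms, for the first `T` rounds. -/
lemma sq_integral_pathMean_sub_le (alg : Algorithm) {ν ν' : Fin K → ProbabilityMeasure ℝ}
    (hK : 0 < K) (φ : (Fin T → Fin K) → ℝ)
    {l : Fin K → ℝ → ℝ} {B : ℝ} (hl : ∀ i, Measurable (l i)) (hl0 : ∀ i x, 0 ≤ l i x)
    (hlB : ∀ i x, l i x ≤ B)
    (hν : ∀ i, (ν' i : Measure ℝ) = (ν i : Measure ℝ).withDensity
      (fun x => ENNReal.ofReal (l i x)))
    (h1 : 1 ≤ ∏ i, ∫ x, l i x ^ 2 ∂(ν i : Measure ℝ)) :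
    ((∫ a, φ a ∂actionLaw alg ⟨K, ν'⟩ T) - ∫ a, φ a ∂actionLaw alg ⟨K, ν⟩ T) ^ 2 ≤
      variance φ (actionLaw alg ⟨K, ν⟩ T) *
        ((∏ i, ∫ x, l i x ^ 2 ∂(ν i : Measure ℝ)) ^ T - 1) := by
  classical
  -- Only the first `T` entries of each row matter; each arm thus contributes `T` equal factors,
  -- whence the power `T` in the conclusion.
  set S : Finset (Fin K × ℕ) := Finset.univ ×ˢ Finset.range T
  set ext : (S → ℝ) → (Fin K × ℕ → ℝ) := fun y p => if h : p ∈ S then y ⟨p, h⟩ else 0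
  have hext : Measurable ext := by
    refine measurable_pi_lambda _ fun p => ?_
    by_cases h : p ∈ S
    · simpa [ext, h] using measurable_pi_apply _
    · simp [ext, h]
  set G : (S → ℝ) → ℝ := fun y => pathMean alg φ (ext y)
  have hGm : Measurable G := (measurable_pathMean alg φ).comp hext
  have hG : ∀ x : Fin K × ℕ → ℝ, pathMean alg φ x = G (S.restrict x) := fun x =>
    pathMean_congr alg φ fun p hp => by simp [ext, S, hp]
  have hint : ∀ ν : Fin K → ProbabilityMeasure ℝ, ∀ H : ℝ → ℝ, Measurable H →
      ∫ x, H (pathMean alg φ x) ∂tableLaw ⟨K, ν⟩ =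
      ∫ y, H (G y) ∂Measure.pi (fun p : S => (ν p.1.1 : Measure ℝ)) := by
    intro ν H hH
    simp_rw [hG]
    exact integral_restrict_infinitePi
      (μ := fun p : Fin K × ℕ => (ν p.1 : Measure ℝ)) (f := fun y => H (G y))
      (hH.comp hGm).aestronglyMeasurable
  have hGL : MemLp G 2 (Measure.pi (fun p : S => (ν p.1.1 : Measure ℝ))) := by
    refine MemLp.of_bound hGm.aestronglyMeasurable (∑ a, |φ a|) (ae_of_all _ fun y => ?_)
    refine (Finset.abs_sum_le_sum_abs _ _).trans (Finset.sum_le_sum fun a _ => ?_)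
    rw [abs_mul, abs_of_nonneg ENNReal.toReal_nonneg]
    exact mul_le_of_le_one_left (abs_nonneg _)
      (ENNReal.toReal_le_of_le_ofReal zero_le_one (by simpa using pathWeight_le_one alg hK _ a))
  have hchi := sq_integral_pi_sub_le (p := fun p : S => (ν p.1.1 : Measure ℝ))
    (q := fun p : S => (ν' p.1.1 : Measure ℝ)) (l := fun p => l p.1.1) (B := B)
    (fun p => hl _) (fun p => hl0 _) (fun p => hlB _) (fun p => hν _) hGL
    (∫ a, φ a ∂actionLaw alg ⟨K, ν⟩ T)
  have hprod : ∏ p : S, ∫ x, l p.1.1 x ^ 2 ∂(ν p.1.1 : Measure ℝ) =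
      (∏ i, ∫ x, l i x ^ 2 ∂(ν i : Measure ℝ)) ^ T := by
    rw [Finset.prod_coe_sort S fun p => ∫ x, l p.1 x ^ 2 ∂(ν p.1 : Measure ℝ),
      Finset.prod_product, ← Finset.prod_pow]
    simp
  have hpos : 0 < (⟨K, ν⟩ : Instance).numArms := hK
  have hprob := isProbabilityMeasure_actionLaw (T := T) alg hpos
  rw [hprod] at hchi
  have hmean : ∀ ν : Fin K → ProbabilityMeasure ℝ,
      ∫ y, G y ∂Measure.pi (fun p : S => (ν p.1.1 : Measure ℝ)) =
        ∫ a, φ a ∂actionLaw alg ⟨K, ν⟩ T := fun ν => by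
    rw [integral_actionLaw alg (show 0 < (⟨K, ν⟩ : Instance).numArms from hK)]
    exact (hint ν id measurable_id).symm
  rw [hmean, hmean, ← hint ν (fun z => (z - ∫ a, φ a ∂actionLaw alg ⟨K, ν⟩ T) ^ 2)
    (by fun_prop)] at hchi
  have hone : 0 ≤ (∏ i, ∫ x, l i x ^ 2 ∂(ν i : Measure ℝ)) ^ T - 1 :=
    sub_nonneg.2 (one_le_pow₀ h1)
  refine hchi.trans (mul_le_mul_of_nonneg_right ?_ hone)
  rw [variance_eq_integral (measurable_of_finite _).aemeasurable]
  exact integral_sq_pathMean_sub_le alg hpos φ _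

end Transfer

/-! ### Two-point reward laws -/

section TwoPoint

variable {σ θ θ' : ℝ}

/-- The weight that a two-point law on `{-σ, σ}` of mean `θ` gives to `σ`. -/
noncomputable def upWeight (σ θ : ℝ) : ℝ := max 0 (min 1 ((1 + θ / σ) / 2))

lemma upWeight_nonneg (σ θ : ℝ) : 0 ≤ upWeight σ θ := le_max_left _ _

lemma upWeight_le_one (σ θ : ℝ) : upWeight σ θ ≤ 1 := max_le zero_le_one (min_le_left _ _)

lemma upWeight_eq (hσ : 0 < σ) (hθ : |θ| ≤ σ) : upWeight σ θ = (1 + θ / σ) / 2 := by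
  have h1 : -1 ≤ θ / σ := by rw [le_div_iff₀ hσ]; linarith [(abs_le.1 hθ).1]
  have h2 : θ / σ ≤ 1 := by rw [div_le_iff₀ hσ]; linarith [(abs_le.1 hθ).2]
  rw [upWeight, min_eq_right (by linarith), max_eq_right (by linarith)]

/-- The law on `{-σ, σ}` of mean `θ`, for `|θ| ≤ σ`. -/
noncomputable def twoPoint (σ θ : ℝ) : ProbabilityMeasure ℝ :=
  ⟨ENNReal.ofReal (upWeight σ θ) • Measure.dirac σ +
    ENNReal.ofReal (1 - upWeight σ θ) • Measure.dirac (-σ), ⟨by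
      have h1 := upWeight_nonneg σ θ
      have h2 := upWeight_le_one σ θ
      simp [← ENNReal.ofReal_add h1 (sub_nonneg.2 h2)]⟩⟩

lemma coe_twoPoint (σ θ : ℝ) : (twoPoint σ θ : Measure ℝ) =
    ENNReal.ofReal (upWeight σ θ) • Measure.dirac σ +
      ENNReal.ofReal (1 - upWeight σ θ) • Measure.dirac (-σ) := rfl

lemma integral_twoPoint (hσ : 0 < σ) (hθ : |θ| ≤ σ) (φ : ℝ → ℝ) :
    ∫ x, φ x ∂(twoPoint σ θ : Measure ℝ) =
      (1 + θ / σ) / 2 * φ σ + (1 - θ / σ) / 2 * φ (-σ) := by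
  have h1 := upWeight_nonneg σ θ
  have h2 := sub_nonneg.2 (upWeight_le_one σ θ)
  rw [coe_twoPoint, integral_add_measure ((integrable_dirac (by simp)).smul_measure (by simp))
    ((integrable_dirac (by simp)).smul_measure (by simp)), integral_smul_measure,
    integral_smul_measure, integral_dirac, integral_dirac, ENNReal.toReal_ofReal h1,
    ENNReal.toReal_ofReal h2, upWeight_eq hσ hθ, smul_eq_mul, smul_eq_mul]
  ring

lemma integral_id_twoPoint (hσ : 0 < σ) (hθ : |θ| ≤ σ) :
    ∫ x, x ∂(twoPoint σ θ : Measure ℝ) = θ := by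
  rw [integral_twoPoint hσ hθ]
  field_simp
  ring

/-- Hoeffding's lemma on an interval of length `2σ` gives exactly the variance proxy `σ ^ 2`. -/
lemma hasSubgaussianMGF_twoPoint (hσ : 0 < σ) (hθ : |θ| ≤ σ) :
    HasSubgaussianMGF (fun x : ℝ => x - θ) (Real.toNNReal (σ ^ 2)) (twoPoint σ θ : Measure ℝ) := by
  have hmem : ∀ᵐ x ∂(twoPoint σ θ : Measure ℝ), id x ∈ Set.Icc (-σ) σ := by
    rw [coe_twoPoint, ae_add_measure_iff]
    constructor <;> refine Measure.ae_smul_measure ?_ _ <;> rw [ae_dirac_eq] <;>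
      simp [hσ.le]
  have h := hasSubgaussianMGF_of_mem_Icc (X := id) aemeasurable_id hmem
  have hc : (‖σ - -σ‖₊ / 2) ^ 2 = Real.toNNReal (σ ^ 2) := by
    ext
    rw [Real.coe_toNNReal _ (sq_nonneg σ)]
    push_cast
    rw [Real.norm_of_nonneg (by linarith)]
    ring
  rw [hc] at h
  simpa only [id, integral_id_twoPoint hσ hθ] using h

/-- The likelihood ratio of `twoPoint σ θ'` with respect to `twoPoint σ θ`. -/
noncomputable def ratio (σ θ θ' x : ℝ) : ℝ :=
  if 0 < x then (1 + θ' / σ) / (1 + θ / σ) else (1 - θ' / σ) / (1 - θ / σ)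

lemma measurable_ratio (σ θ θ' : ℝ) : Measurable (ratio σ θ θ') :=
  Measurable.ite measurableSet_Ioi measurable_const measurable_const

lemma one_add_div_pos (hσ : 0 < σ) (hθ : |θ| < σ) : 0 < 1 + θ / σ ∧ 0 < 1 - θ / σ := by
  have h1 : -1 < θ / σ := by rw [lt_div_iff₀ hσ]; linarith [(abs_lt.1 hθ).1]
  have h2 : θ / σ < 1 := by rw [div_lt_iff₀ hσ]; linarith [(abs_lt.1 hθ).2]
  exact ⟨by linarith, by linarith⟩

lemma ratio_nonneg (hσ : 0 < σ) (hθ : |θ| < σ) (hθ' : |θ'| < σ) (x : ℝ) : 0 ≤ ratio σ θ θ' x := by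
  obtain ⟨h1, h2⟩ := one_add_div_pos hσ hθ
  obtain ⟨h3, h4⟩ := one_add_div_pos hσ hθ'
  unfold ratio
  split_ifs <;> positivity

lemma ratio_le (hσ : 0 < σ) (hθ : |θ| < σ) (hθ' : |θ'| < σ) (x : ℝ) : ratio σ θ θ' x ≤
    (1 + θ' / σ) / (1 + θ / σ) + (1 - θ' / σ) / (1 - θ / σ) := by
  obtain ⟨h1, h2⟩ := one_add_div_pos hσ hθ
  obtain ⟨h3, h4⟩ := one_add_div_pos hσ hθ'
  unfold ratio
  split_ifs
  · exact le_add_of_nonneg_right (by positivity)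
  · exact le_add_of_nonneg_left (by positivity)

lemma twoPoint_eq_withDensity (hσ : 0 < σ) (hθ : |θ| < σ) (hθ' : |θ'| < σ) :
    (twoPoint σ θ' : Measure ℝ) =
      (twoPoint σ θ : Measure ℝ).withDensity (fun x => ENNReal.ofReal (ratio σ θ θ' x)) := by
  obtain ⟨h1, h2⟩ := one_add_div_pos hσ hθ
  obtain ⟨h3, h4⟩ := one_add_div_pos hσ hθ'
  ext s hs
  rw [withDensity_apply _ hs, ← lintegral_indicator hs, coe_twoPoint σ θ, lintegral_add_measure,
    lintegral_smul_measure, lintegral_smul_measure, lintegral_dirac, lintegral_dirac, coe_twoPoint,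
    Measure.add_apply, Measure.smul_apply, Measure.smul_apply, Measure.dirac_apply' _ hs,
    Measure.dirac_apply' _ hs, upWeight_eq hσ hθ.le, upWeight_eq hσ hθ'.le]
  have e1 : ENNReal.ofReal ((1 + θ / σ) / 2) * ENNReal.ofReal (ratio σ θ θ' σ) =
      ENNReal.ofReal ((1 + θ' / σ) / 2) := by
    rw [← ENNReal.ofReal_mul (by positivity), ratio, if_pos hσ]
    congr 1
    rw [div_mul_div_comm, mul_comm 2, mul_div_mul_left _ _ h1.ne']
  have hhalf : ∀ t : ℝ, 1 - (1 + t / σ) / 2 = (1 - t / σ) / 2 := fun t => by ring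
  have e2 : ENNReal.ofReal (1 - (1 + θ / σ) / 2) * ENNReal.ofReal (ratio σ θ θ' (-σ)) =
      ENNReal.ofReal (1 - (1 + θ' / σ) / 2) := by
    rw [← ENNReal.ofReal_mul (by linarith), ratio, if_neg (by linarith)]
    congr 1
    rw [hhalf, hhalf, div_mul_div_comm, mul_comm 2, mul_div_mul_left _ _ h2.ne']
  congr 1
  · by_cases h : σ ∈ s <;> simp [h, e1]
  · by_cases h : -σ ∈ s <;> simp [h, e2]

lemma integral_sq_ratio (hσ : 0 < σ) (hθ : |θ| < σ) :
    ∫ x, ratio σ θ θ' x ^ 2 ∂(twoPoint σ θ : Measure ℝ) =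
      1 + (θ' - θ) ^ 2 / (σ ^ 2 - θ ^ 2) := by
  obtain ⟨h1, h2⟩ := one_add_div_pos hσ hθ
  rw [integral_twoPoint hσ hθ.le, ratio, ratio, if_pos hσ, if_neg (by linarith)]
  have h3 : 0 < σ + θ := by linarith [(abs_lt.1 hθ).1]
  have h4 : 0 < σ - θ := by linarith [(abs_lt.1 hθ).2]
  have h5 : σ ^ 2 - θ ^ 2 = (σ + θ) * (σ - θ) := by ring
  have e1 : 1 + θ / σ = (σ + θ) / σ := by field_simp
  have e2 : 1 - θ / σ = (σ - θ) / σ := by field_simp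
  have e3 : 1 + θ' / σ = (σ + θ') / σ := by field_simp
  have e4 : 1 - θ' / σ = (σ - θ') / σ := by field_simp
  rw [h5, e1, e2, e3, e4]
  field_simp
  ring

lemma integral_sq_ratio_self (hσ : 0 < σ) (hθ : |θ| < σ) :
    ∫ x, ratio σ θ θ x ^ 2 ∂(twoPoint σ θ : Measure ℝ) = 1 := by
  rw [integral_sq_ratio hσ hθ]; simp

end TwoPoint

/-! ### Small regret forces large variability -/

section HardInstance

variable {σ θ θ' δ M : ℝ} {Kbar T : ℕ}

/-- Two arms with rewards in `{-σ, σ}`, the first of mean `θ` and the second of mean `0`. -/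
noncomputable def hardInstance (σ θ : ℝ) : Instance :=
  ⟨2, fun i => twoPoint σ (if i = 0 then θ else 0)⟩

lemma mean_hardInstance (hσ : 0 < σ) (hθ : |θ| ≤ σ) (i : Fin 2) :
    (hardInstance σ θ).mean i = if i = 0 then θ else 0 := by
  refine integral_id_twoPoint hσ ?_
  split_ifs
  · exact hθ
  · simpa using hσ.le

lemma hardInstance_mem (hσ : 0 < σ) (hM : 0 < M) (hθ : |θ| ≤ σ) (hθM : |θ| ≤ M) (hK : 2 ≤ Kbar) :
    hardInstance σ θ ∈ subGaussianClass M σ Kbar := by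
  refine ⟨le_rfl, hK, fun (i : Fin 2) => ?_⟩
  have hi : |if i = 0 then θ else 0| ≤ σ := by
    split_ifs
    · exact hθ
    · simpa using hσ.le
  have hiM : |if i = 0 then θ else 0| ≤ M := by
    split_ifs
    · exact hθM
    · simpa using hM.le
  rw [mean_hardInstance hσ hθ]
  exact ⟨abs_le.1 hiM, hasSubgaussianMGF_twoPoint hσ hi⟩

lemma sq_integral_hardInstance_sub_le (alg : Algorithm) (hσ : 0 < σ) (hθ : |θ| < σ)
    (hθ' : |θ'| < σ) (φ : (Fin T → Fin 2) → ℝ) :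
    ((∫ a, φ a ∂actionLaw alg (hardInstance σ θ') T) -
      ∫ a, φ a ∂actionLaw alg (hardInstance σ θ) T) ^ 2 ≤
      variance φ (actionLaw alg (hardInstance σ θ) T) *
        ((1 + (θ' - θ) ^ 2 / (σ ^ 2 - θ ^ 2)) ^ T - 1) := by
  have h0 : |(0 : ℝ)| < σ := by simpa using hσ
  have hlt : ∀ (θ : ℝ), |θ| < σ → ∀ i : Fin 2, |if i = 0 then θ else 0| < σ := by
    intro θ hθ i
    split_ifs
    · exact hθ
    · exact h0
  have hprod : ∏ i : Fin 2, ∫ x, ratio σ (if i = 0 then θ else 0) (if i = 0 then θ' else 0) x ^ 2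
      ∂(twoPoint σ (if i = 0 then θ else 0) : Measure ℝ) =
      1 + (θ' - θ) ^ 2 / (σ ^ 2 - θ ^ 2) := by
    rw [Fin.prod_univ_two]
    simp [integral_sq_ratio hσ hθ, integral_sq_ratio_self hσ h0]
  have hθ2 : 0 < σ ^ 2 - θ ^ 2 := by
    have := sq_lt_sq' (by linarith [(abs_lt.1 hθ).1]) (abs_lt.1 hθ).2
    linarith
  have hB : ∀ i : Fin 2, ∀ x,
      ratio σ (if i = 0 then θ else 0) (if i = 0 then θ' else 0) x ≤
      ((1 + θ' / σ) / (1 + θ / σ) + (1 - θ' / σ) / (1 - θ / σ)) + 2 := by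
    intro i x
    by_cases hi : i = 0
    · simp only [hi, if_true]
      linarith [ratio_le hσ hθ hθ' x]
    · simp only [hi, if_false]
      have h1 := ratio_le hσ h0 h0 x
      have h2 := (ratio_nonneg hσ hθ hθ' 0).trans (ratio_le hσ hθ hθ' 0)
      norm_num at h1
      linarith
  have h := sq_integral_pathMean_sub_le alg
    (ν := fun i : Fin 2 => twoPoint σ (if i = 0 then θ else 0))
    (ν' := fun i : Fin 2 => twoPoint σ (if i = 0 then θ' else 0)) two_pos φ
    (l := fun i => ratio σ (if i = 0 then θ else 0) (if i = 0 then θ' else 0))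
    (fun i => measurable_ratio _ _ _) (fun i => ratio_nonneg hσ (hlt θ hθ i) (hlt θ' hθ' i)) hB
    (fun i => twoPoint_eq_withDensity hσ (hlt θ hθ i) (hlt θ' hθ' i))
    (by rw [hprod]; exact le_add_of_nonneg_right (by positivity))
  rw [hprod] at h
  exact h

lemma variance_le_variability_sq (alg : Algorithm) (ν : Instance) (T : ℕ) (i : Fin ν.numArms) :
    variance (fun a => (pulls a i : ℝ)) (actionLaw alg ν T) ≤ variability alg ν T ^ 2 := by
  have h := le_ciSup (f := fun i : Fin ν.numArms =>
    √(variance (fun a => (pulls a i : ℝ)) (actionLaw alg ν T))) (Set.finite_range _).bddAbove i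
  have h2 := pow_le_pow_left₀ (Real.sqrt_nonneg _) h 2
  rwa [Real.sq_sqrt (variance_nonneg _ _)] at h2

lemma variability_nonneg (alg : Algorithm) (ν : Instance) (T : ℕ) : 0 ≤ variability alg ν T :=
  Real.iSup_nonneg fun _ => Real.sqrt_nonneg _

/-- Shifting the mean of the first arm by a small amount changes its expected number of pulls by
a multiple of the allocation variability. -/
lemma integral_pulls_sub_le (alg : Algorithm) (hσ : 0 < σ) (hθ : |θ| ≤ σ / 2)
    (hθ' : |θ'| ≤ σ / 2) (hT : 2 * T * (θ' - θ) ^ 2 ≤ σ ^ 2) (i : Fin 2) :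
    (∫ a, (pulls a i : ℝ) ∂actionLaw alg (hardInstance σ θ') T) -
      ∫ a, (pulls a i : ℝ) ∂actionLaw alg (hardInstance σ θ) T ≤
      variability alg (hardInstance σ θ) T * (2 * √(T : ℝ) * |θ' - θ| / σ) := by
  have h := sq_integral_hardInstance_sub_le alg hσ (by linarith : |θ| < σ) (by linarith : |θ'| < σ)
    (fun a : Fin T → Fin 2 => (pulls a i : ℝ))
  have hV := variance_le_variability_sq alg (hardInstance σ θ) T i
  have hθ2 : σ ^ 2 / 2 ≤ σ ^ 2 - θ ^ 2 := by
    have h1 := sq_le_sq' (by linarith [neg_abs_le θ, abs_nonneg θ]) (le_abs_self θ |>.trans hθ)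
    nlinarith
  set u := (θ' - θ) ^ 2 / (σ ^ 2 - θ ^ 2)
  have hσ2 : 0 < σ ^ 2 / 2 := by positivity
  have hu0 : 0 ≤ u := div_nonneg (sq_nonneg _) (hσ2.le.trans hθ2)
  have hu : u ≤ 2 * (θ' - θ) ^ 2 / σ ^ 2 := by
    calc u ≤ (θ' - θ) ^ 2 / (σ ^ 2 / 2) := by simp only [u]; gcongr
      _ = _ := by field_simp
  have hTu : T * u ≤ 1 := by
    calc T * u ≤ T * (2 * (θ' - θ) ^ 2 / σ ^ 2) := by gcongr
      _ = 2 * T * (θ' - θ) ^ 2 / σ ^ 2 := by ring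
      _ ≤ 1 := (div_le_one (by positivity)).2 hT
  have hTu0 : 0 ≤ T * u := by positivity
  -- `hT` gives `T * u ≤ 1`, where `exp y - 1 ≤ 2 * y` keeps the divergence linear in `T * u`.
  have hpow : (1 + u) ^ T - 1 ≤ (2 * √(T : ℝ) * |θ' - θ| / σ) ^ 2 := by
    have h1 : (1 + u) ^ T ≤ Real.exp (T * u) := by
      rw [Real.exp_nat_mul]
      exact pow_le_pow_left₀ (by linarith) (by linarith [Real.add_one_le_exp u]) T
    have h2 : Real.exp (T * u) - 1 ≤ 2 * (T * u) := by
      have := Real.abs_exp_sub_one_le (x := T * u) (by rwa [abs_of_nonneg hTu0])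
      rw [abs_of_nonneg hTu0] at this
      exact (le_abs_self _).trans this
    calc (1 + u) ^ T - 1 ≤ 2 * (T * u) := by linarith
      _ ≤ 2 * (T * (2 * (θ' - θ) ^ 2 / σ ^ 2)) := by gcongr
      _ = (2 * √(T : ℝ) * |θ' - θ| / σ) ^ 2 := by
        rw [div_pow, mul_pow, mul_pow, Real.sq_sqrt (Nat.cast_nonneg T), sq_abs]
        ring
  have hpow0 : 0 ≤ (1 + u) ^ T - 1 := sub_nonneg.2 (one_le_pow₀ (by linarith))
  have hsq := h.trans (mul_le_mul hV hpow hpow0 (sq_nonneg _))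
  rw [← mul_pow] at hsq
  exact le_of_sq_le_sq hsq (mul_nonneg (variability_nonneg _ _ _) (by positivity))

/-- If the allocation variability is small throughout, then the expected number of pulls of the
first arm varies slowly with its mean. -/
lemma integral_pulls_sub_le_of_variability_le (alg : Algorithm) (hσ : 0 < σ) (hδ : 0 < δ)
    (hδσ : δ ≤ σ / 2) {S : ℝ}
    (hS : ∀ θ, |θ| ≤ δ → variability alg (hardInstance σ θ) T ≤ S) (i : Fin 2) :
    (∫ a, (pulls a i : ℝ) ∂actionLaw alg (hardInstance σ δ) T) -
      ∫ a, (pulls a i : ℝ) ∂actionLaw alg (hardInstance σ (-δ)) T ≤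
      4 * S * √(T : ℝ) * δ / σ := by
  -- A single change of measure from `-δ` to `δ` could cost exponentially in `T * δ ^ 2`. Here `[-δ,
  -- δ]` is cut into `m` steps fine enough for `integral_pulls_sub_le`, the `+ 1` ensuring `m > 0`;
  -- the telescoped bound no longer depends on `m`.
  obtain ⟨m, hm⟩ := exists_nat_ge (4 * δ * √(T : ℝ) / σ + 1)
  have hm0 : (0 : ℝ) < m := lt_of_lt_of_le (by positivity) hm
  set h := 2 * δ / m
  have hh : 0 < h := by positivity
  have hmh : m * h = 2 * δ := by simp only [h]; field_simp
  set E : ℕ → ℝ := fun k => ∫ a, (pulls a i : ℝ) ∂actionLaw alg (hardInstance σ (-δ + k * h)) T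
  have hθ : ∀ k : ℕ, k ≤ m → |-δ + k * h| ≤ δ := by
    intro k hk
    have h1 : (k : ℝ) * h ≤ m * h := by gcongr
    have h2 : 0 ≤ (k : ℝ) * h := by positivity
    rw [abs_le]
    constructor <;> linarith
  have hsmall : 2 * T * h ^ 2 ≤ σ ^ 2 := by
    have h1 : 4 * δ * √(T : ℝ) ≤ m * σ := by
      rw [← div_le_iff₀ hσ]; linarith
    have h2 : 2 * h * √(T : ℝ) ≤ σ := by
      have : m * (2 * h * √(T : ℝ)) ≤ m * σ := by
        calc m * (2 * h * √(T : ℝ)) = 2 * (m * h) * √(T : ℝ) := by ring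
          _ = 4 * δ * √(T : ℝ) := by rw [hmh]; ring
          _ ≤ _ := h1
      exact le_of_mul_le_mul_left this hm0
    have h3 := pow_le_pow_left₀ (by positivity) h2 2
    rw [mul_pow, Real.sq_sqrt (Nat.cast_nonneg T)] at h3
    have : 0 ≤ (T : ℝ) * h ^ 2 := by positivity
    nlinarith
  have hstep : ∀ k ∈ Finset.range m, E (k + 1) - E k ≤ S * (2 * √(T : ℝ) * h / σ) := by
    intro k hk
    have hk' := Finset.mem_range.1 hk
    have hdiff : (-δ + ((k + 1 : ℕ) : ℝ) * h) - (-δ + k * h) = h := by push_cast; ring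
    have := integral_pulls_sub_le (T := T) alg hσ ((hθ k hk'.le).trans hδσ)
      ((hθ (k + 1) hk').trans hδσ) (by rwa [hdiff]) i
    rw [hdiff, abs_of_pos hh] at this
    refine this.trans ?_
    gcongr
    exact hS _ (hθ k hk'.le)
  have hsum := Finset.sum_le_card_nsmul _ _ _ hstep
  rw [Finset.sum_range_sub, Finset.card_range, nsmul_eq_mul] at hsum
  have hEm : E m = ∫ a, (pulls a i : ℝ) ∂actionLaw alg (hardInstance σ δ) T := by
    simp only [E]
    rw [hmh]
    congr 3
    ring
  have hE0 : E 0 = ∫ a, (pulls a i : ℝ) ∂actionLaw alg (hardInstance σ (-δ)) T := by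
    simp only [E]
    congr 3
    simp
  rw [hEm, hE0] at hsum
  refine hsum.trans_eq ?_
  calc m * (S * (2 * √(T : ℝ) * h / σ)) = S * (2 * √(T : ℝ) * (m * h) / σ) := by ring
    _ = _ := by rw [hmh]; ring

lemma integral_pulls_add (alg : Algorithm) (σ θ : ℝ) (T : ℕ) :
    (∫ a, (pulls a (0 : Fin 2) : ℝ) ∂actionLaw alg (hardInstance σ θ) T) +
      ∫ a, (pulls a (1 : Fin 2) : ℝ) ∂actionLaw alg (hardInstance σ θ) T = T := by
  have := isProbabilityMeasure_actionLaw (T := T) alg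
    (show 0 < (hardInstance σ θ).numArms from two_pos)
  rw [← integral_add Integrable.of_finite Integrable.of_finite]
  have : ∀ a : Fin T → Fin 2, (pulls a 0 : ℝ) + pulls a 1 = T := by
    intro a
    have h : ∑ i, pulls a i = T := by
      have := Finset.card_eq_sum_card_fiberwise (f := a) (s := Finset.univ) (t := Finset.univ)
        (fun _ _ => Finset.mem_coe.2 (Finset.mem_univ _))
      simpa [pulls] using this.symm
    rw [Fin.sum_univ_two] at h
    exact_mod_cast h
  calc _ = ∫ _a : Fin T → Fin (hardInstance σ θ).numArms, (T : ℝ) ∂actionLaw alg (hardInstance σ θ) T :=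
        integral_congr_ae (ae_of_all _ this)
    _ = T := by simp

lemma gap_mul_le_regret (alg : Algorithm) (ν : Instance) (T : ℕ) (i j : Fin ν.numArms) :
    (ν.mean j - ν.mean i) * ∫ a, (pulls a i : ℝ) ∂actionLaw alg ν T ≤ regret alg ν T := by
  have hE : ∀ i, 0 ≤ ∫ a, (pulls a i : ℝ) ∂actionLaw alg ν T := fun i =>
    integral_nonneg fun a => Nat.cast_nonneg _
  have hle : ∀ i, ν.mean i ≤ ⨆ j, ν.mean j := fun i => le_ciSup (Set.finite_range _).bddAbove i
  calc _ ≤ ν.gap i * ∫ a, (pulls a i : ℝ) ∂actionLaw alg ν T := by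
        refine mul_le_mul_of_nonneg_right ?_ (hE i)
        exact sub_le_sub_right (hle j) _
    _ ≤ regret alg ν T := Finset.single_le_sum
        (f := fun i => ν.gap i * ∫ a, (pulls a i : ℝ) ∂actionLaw alg ν T)
        (fun k _ => mul_nonneg (sub_nonneg.2 (hle k)) (hE k)) (Finset.mem_univ i)

lemma regret_nonneg (alg : Algorithm) (ν : Instance) (T : ℕ) : 0 ≤ regret alg ν T :=
  Finset.sum_nonneg fun i _ => mul_nonneg
    (sub_nonneg.2 (le_ciSup (Set.finite_range _).bddAbove i))
    (integral_nonneg fun _ => Nat.cast_nonneg _)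

/-- Small regret forces a large allocation variability somewhere. -/
lemma exists_variability_gt (alg : Algorithm) (hσ : 0 < σ) (hδ : 0 < δ)
    (hδσ : δ ≤ σ / 2) (hT : 0 < T)
    (hR : ∀ θ, |θ| ≤ δ → regret alg (hardInstance σ θ) T < δ * T / 4) :
    ∃ θ, |θ| ≤ δ ∧ σ * √(T : ℝ) / (16 * δ) < variability alg (hardInstance σ θ) T := by
  by_contra! hS
  have hTR : (0 : ℝ) < T := by exact_mod_cast hT
  have hδ1 : |δ| ≤ δ := (abs_of_pos hδ).le
  have hδ2 : |-δ| ≤ δ := by rw [abs_neg]; exact hδ1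
  have h := integral_pulls_sub_le_of_variability_le alg hσ hδ hδσ hS 0
  -- The assumed variability allows a change of only `T/4`, whereas the regret bounds at `δ` and
  -- `-δ` put the expected pulls of arm `0` above `3T/4` and below `T/4`.
  have hval : 4 * (σ * √(T : ℝ) / (16 * δ)) * √(T : ℝ) * δ / σ = T / 4 := by
    have := Real.mul_self_sqrt hTR.le
    field_simp
    rw [Real.sq_sqrt hTR.le]
    ring
  rw [hval] at h
  have h1 := (gap_mul_le_regret alg (hardInstance σ δ) T (1 : Fin 2) (0 : Fin 2)).trans_lt
    (hR δ hδ1)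
  have h2 := (gap_mul_le_regret alg (hardInstance σ (-δ)) T (0 : Fin 2) (1 : Fin 2)).trans_lt
    (hR (-δ) hδ2)
  rw [mean_hardInstance hσ (hδ1.trans (by linarith)),
    mean_hardInstance hσ (hδ1.trans (by linarith))] at h1
  rw [mean_hardInstance hσ (hδ2.trans (by linarith)),
    mean_hardInstance hσ (hδ2.trans (by linarith))] at h2
  have h3 := integral_pulls_add alg σ δ T
  set a₀ := ∫ a, (pulls a (0 : Fin 2) : ℝ) ∂actionLaw alg (hardInstance σ δ) T
  set a₁ := ∫ a, (pulls a (1 : Fin 2) : ℝ) ∂actionLaw alg (hardInstance σ δ) T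
  set b₀ := ∫ a, (pulls a (0 : Fin 2) : ℝ) ∂actionLaw alg (hardInstance σ (-δ)) T
  have h1' : δ * a₁ < δ * (T / 4) := by simpa [mul_div_assoc] using h1
  have h2' : δ * b₀ < δ * (T / 4) := by simpa [mul_div_assoc] using h2
  have h4 := lt_of_mul_lt_mul_left h1' hδ.le
  have h5 := lt_of_mul_lt_mul_left h2' hδ.le
  linarith

end HardInstance

/-! ### The two rates -/

variable {M σ ρ : ℝ} {Kbar T : ℕ}

lemma variability_le_horizon (alg : Algorithm) (ν : Instance) (hK : 0 < ν.numArms) (T : ℕ) :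
    variability alg ν T ≤ T := by
  have : Nonempty (Fin ν.numArms) := ⟨⟨0, hK⟩⟩
  have := isProbabilityMeasure_actionLaw (T := T) alg hK
  refine ciSup_le fun i => Real.sqrt_le_iff.2 ⟨Nat.cast_nonneg T, ?_⟩
  refine (variance_le_sq_of_bounded (a := 0) (b := T) (ae_of_all _ fun a =>
    ⟨Nat.cast_nonneg _, pulls_le a i⟩) (measurable_of_finite _).aemeasurable).trans ?_
  have : (0 : ℝ) ≤ T := Nat.cast_nonneg T
  nlinarith

/-- The balance `v = S ^ ρ` with `S = T ^ (3/2) / v`, written for `v = T ^ (3ρ / (2 + 2ρ))`. -/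
lemma exponent_identity (hρ : 0 ≤ ρ) :
    (3 / 2 - 3 * ρ / (2 + 2 * ρ)) * ρ = 3 * ρ / (2 + 2 * ρ) := by
  field_simp
  ring

/-- Every algorithm suffers a loss of order at least `√T ∨ (T ^ (3ρ / (2 + 2ρ)) ∧ T)`. -/
theorem le_worstLoss (hM : 0 < M) (hσ : 0 < σ) (hK : 2 ≤ Kbar) (hρ : 0 ≤ ρ) :
    ∃ c : ℝ, 0 < c ∧ ∀ alg : Algorithm, ∀ T : ℕ, 1 ≤ T →
      ENNReal.ofReal (c * max (√(T : ℝ)) (min ((T : ℝ) ^ (3 * ρ / (2 + 2 * ρ))) (T : ℝ))) ≤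
        worstLoss M σ Kbar ρ alg T := by
  -- `σ / 64` makes the factor `σ / (64 * c)` in the variability bound at least one; with `δ ≤ 4 *
  -- c`, the two bounds on `c` also keep the hard instances in the class.
  set c : ℝ := min 1 (min (σ / 64) (M / 4))
  have hc : 0 < c := by positivity
  have hc1 : c ≤ 1 := min_le_left _ _
  have hcσ : c ≤ σ / 64 := (min_le_right _ _).trans (min_le_left _ _)
  have hcM : c ≤ M / 4 := (min_le_right _ _).trans (min_le_right _ _)
  refine ⟨c, hc, fun alg T hT => ?_⟩
  by_contra! hlt
  have hTR : (1 : ℝ) ≤ T := by exact_mod_cast hT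
  have hT0 : (0 : ℝ) < T := by linarith
  have hsq : 0 < √(T : ℝ) := Real.sqrt_pos.2 hT0
  have hsqT : √(T : ℝ) ≤ T := Real.sqrt_le_iff.2 ⟨hT0.le, by nlinarith⟩
  set α := 3 * ρ / (2 + 2 * ρ)
  set v := max (√(T : ℝ)) (min ((T : ℝ) ^ α) (T : ℝ))
  have hv0 : 0 < v := hsq.trans_le (le_max_left _ _)
  have hvT : v ≤ T := max_le hsqT (min_le_right _ _)
  have hloss : ∀ ν ∈ subGaussianClass M σ Kbar,
      regret alg ν T + variability alg ν T ^ ρ < c * v := by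
    intro ν hν
    have h1 : ENNReal.ofReal (regret alg ν T + variability alg ν T ^ ρ) ≤
        worstLoss M σ Kbar ρ alg T := le_iSup₂ (f := fun ν (_ : ν ∈ subGaussianClass M σ Kbar) =>
          ENNReal.ofReal (regret alg ν T + variability alg ν T ^ ρ)) ν hν
    exact ((ENNReal.ofReal_lt_ofReal_iff (by positivity)).1 (h1.trans_lt hlt))
  -- Chosen so that `δ * T / 4` is exactly the assumed bound `c * v` on the loss.
  set δ := 4 * (c * v) / T
  have hδ : 0 < δ := by positivity
  have hδT : δ * T / 4 = c * v := by simp only [δ]; field_simp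
  have hδc : δ ≤ 4 * c := by
    simp only [δ]
    rw [div_le_iff₀ hT0]
    nlinarith
  have hmem : ∀ θ, |θ| ≤ δ → hardInstance σ θ ∈ subGaussianClass M σ Kbar := fun θ hθ =>
    hardInstance_mem hσ hM (by linarith) (by linarith) hK
  obtain ⟨θ, hθ, hS⟩ := exists_variability_gt (T := T) alg hσ hδ (by linarith) hT fun θ hθ => by
    have h1 := hloss _ (hmem θ hθ)
    have h2 := Real.rpow_nonneg (variability_nonneg alg (hardInstance σ θ) T) ρ
    rw [hδT]; linarith
  have hS' : √(T : ℝ) * T / v ≤ variability alg (hardInstance σ θ) T := by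
    refine le_trans ?_ hS.le
    have h1 : σ * √(T : ℝ) / (16 * δ) = (σ / (64 * c)) * (√(T : ℝ) * T / v) := by
      simp only [δ]; field_simp; ring
    rw [h1]
    refine le_mul_of_one_le_left (by positivity) ?_
    rw [one_le_div (by positivity)]
    linarith
  have hSle := variability_le_horizon alg (hardInstance σ θ) two_pos T
  -- When `v = √T`, the forced variability exceeds `T`, which is impossible for counts in `[0, T]`.
  -- Otherwise `v ≤ T ^ α`, and the `ρ`-th power of the variability already reaches `v`.
  rcases le_total (min ((T : ℝ) ^ α) (T : ℝ)) (√(T : ℝ)) with hcase | hcase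
  · have hv : v = √(T : ℝ) := max_eq_left hcase
    have hval : σ * √(T : ℝ) / (16 * δ) = σ / (64 * c) * T := by
      simp only [δ, hv]; field_simp; ring
    rw [hval] at hS
    have : (1 : ℝ) * T ≤ σ / (64 * c) * T := by
      gcongr
      rw [one_le_div (by positivity)]
      linarith
    linarith
  · have hv : v = min ((T : ℝ) ^ α) (T : ℝ) := max_eq_right hcase
    have hvα : v ≤ (T : ℝ) ^ α := hv.trans_le (min_le_left _ _)
    have h1 : (T : ℝ) ^ (3 / 2 - α) ≤ √(T : ℝ) * T / v := by
      rw [Real.rpow_sub hT0]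
      have h2 : (T : ℝ) ^ (3 / 2 : ℝ) = √(T : ℝ) * T := by
        rw [Real.sqrt_eq_rpow]
        nth_rewrite 3 [← Real.rpow_one (T : ℝ)]
        rw [← Real.rpow_add hT0]
        norm_num
      rw [h2]
      gcongr
    have h2 : (T : ℝ) ^ α ≤ variability alg (hardInstance σ θ) T ^ ρ := by
      have hα : (3 / 2 - α) * ρ = α := exponent_identity hρ
      rw [show (T : ℝ) ^ α = (T : ℝ) ^ ((3 / 2 - α) * ρ) by rw [hα], Real.rpow_mul hT0.le]
      exact Real.rpow_le_rpow (Real.rpow_nonneg hT0.le _) (h1.trans hS') hρ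
    have h3 := hloss _ (hmem θ hθ)
    have h4 := regret_nonneg alg (hardInstance σ θ) T
    have h5 : c * v ≤ v := mul_le_of_le_one_left hv0.le hc1
    linarith

lemma rate_pos (hT : 1 ≤ T) : 0 < max (√(T : ℝ)) (min ((T : ℝ) ^ (3 * ρ / (2 + 2 * ρ))) (T : ℝ)) :=
  lt_of_lt_of_le (Real.sqrt_pos.2 (by exact_mod_cast hT)) (le_max_left _ _)

lemma rate_eq (hρ : 0 ≤ ρ) (hρ' : ρ ≤ 2) (hT : 1 ≤ T) :
    max (√(T : ℝ)) (min ((T : ℝ) ^ (3 * ρ / (2 + 2 * ρ))) (T : ℝ)) =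
      max (√(T : ℝ)) ((T : ℝ) ^ (3 * ρ / (2 + 2 * ρ))) := by
  have hTR : (1 : ℝ) ≤ T := by exact_mod_cast hT
  rw [min_eq_left]
  calc (T : ℝ) ^ (3 * ρ / (2 + 2 * ρ)) ≤ (T : ℝ) ^ (1 : ℝ) := by
        refine Real.rpow_le_rpow_of_exponent_le hTR ?_
        rw [div_le_one (by positivity)]
        linarith
    _ = T := Real.rpow_one _

lemma rpow_le_rate (hT : 1 ≤ T) {x : ℝ} (hx : x ≤ 1 / 2 ∨ x ≤ 3 * ρ / (2 + 2 * ρ)) :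
    (T : ℝ) ^ x ≤ max (√(T : ℝ)) ((T : ℝ) ^ (3 * ρ / (2 + 2 * ρ))) := by
  have hTR : (1 : ℝ) ≤ T := by exact_mod_cast hT
  rw [Real.sqrt_eq_rpow, le_max_iff]
  exact hx.imp (Real.rpow_le_rpow_of_exponent_le hTR) (Real.rpow_le_rpow_of_exponent_le hTR)

/-- For `ρ ≥ 1/2` both exponents equal `3ρ / (2 + 2ρ)`; for smaller `ρ` no extra exploration is
needed and `√T` dominates. The condition `β ≤ 1/2` is where `ρ ≤ 2` enters. -/
lemma exploration_exponent (hρ : 0 ≤ ρ) (hρ' : ρ ≤ 2) {β : ℝ}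
    (hβ : β = max ((2 * ρ - 1) / (2 + 2 * ρ)) 0) :
    0 ≤ β ∧ β ≤ 1 / 2 ∧ (β + 1 / 2 ≤ 1 / 2 ∨ β + 1 / 2 ≤ 3 * ρ / (2 + 2 * ρ)) ∧
      ((1 - β) * ρ ≤ 1 / 2 ∨ (1 - β) * ρ ≤ 3 * ρ / (2 + 2 * ρ)) := by
  have h2 : 0 < 2 + 2 * ρ := by positivity
  rcases le_total ρ (1 / 2) with h | h
  · have : β = 0 := by
      rw [hβ, max_eq_right]
      exact div_nonpos_of_nonpos_of_nonneg (by linarith) h2.le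
    subst this
    refine ⟨le_rfl, by norm_num, Or.inl (by norm_num), Or.inl (by linarith)⟩
  · have : β = (2 * ρ - 1) / (2 + 2 * ρ) := by
      rw [hβ, max_eq_left]
      exact div_nonneg (by linarith) h2.le
    refine ⟨hβ ▸ le_max_right _ _, ?_, Or.inr (le_of_eq ?_), Or.inr (le_of_eq ?_)⟩
    · rw [this, div_le_iff₀ h2]; linarith
    · rw [this]; field_simp; ring
    · rw [this]; field_simp; ring

/-- The loss of UCB with exploration `t ^ ((2ρ - 1) / (2 + 2ρ))⁺ * log t`. -/
theorem worstLoss_ucb_le (hM : 0 < M) (hσ : 0 < σ) (hρ : 0 ≤ ρ) (hρ' : ρ ≤ 2) :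
    ∃ C : ℝ, 0 < C ∧ ∀ᶠ T : ℕ in atTop, ∀ alg,
      IsUCB (explore (max ((2 * ρ - 1) / (2 + 2 * ρ)) 0)) alg →
      worstLoss M σ Kbar ρ alg T ≤ ENNReal.ofReal
        (C * max (√(T : ℝ)) ((T : ℝ) ^ (3 * ρ / (2 + 2 * ρ))) * Real.log T) := by
  obtain ⟨hβ0, hβ1, hexpR, hexpS⟩ := exploration_exponent hρ hρ' rfl
  set β := max ((2 * ρ - 1) / (2 + 2 * ρ)) 0
  obtain ⟨C, hC, hev⟩ := ucb_bounds (Kbar := Kbar) hM hσ hβ0 hβ1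
  have hCρ : 0 < C ^ ρ := Real.rpow_pos_of_pos hC ρ
  refine ⟨C + C ^ ρ, by positivity, ?_⟩
  filter_upwards [hev, eventually_ge_atTop 1,
    (Real.tendsto_log_atTop.comp tendsto_natCast_atTop_atTop).eventually_ge_atTop 1]
    with T hT hT1 hlog alg halg
  refine iSup₂_le fun ν hν => ENNReal.ofReal_le_ofReal ?_
  obtain ⟨hR, hS⟩ := hT alg halg ν hν
  have hT0 : (0 : ℝ) ≤ T := Nat.cast_nonneg T
  have hlog' : 1 ≤ Real.log T := hlog
  set v := max (√(T : ℝ)) ((T : ℝ) ^ (3 * ρ / (2 + 2 * ρ)))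
  have hv : 0 ≤ v := (Real.sqrt_nonneg _).trans (le_max_left _ _)
  have h1 : regret alg ν T ≤ C * (v * Real.log T) := by
    refine hR.trans ?_
    gcongr
    exact rpow_le_rate hT1 hexpR
  have h2 : variability alg ν T ^ ρ ≤ C ^ ρ * (v * Real.log T) := by
    calc variability alg ν T ^ ρ ≤ (C * (T : ℝ) ^ (1 - β)) ^ ρ :=
          Real.rpow_le_rpow (variability_nonneg _ _ _) hS hρ
      _ = C ^ ρ * (T : ℝ) ^ ((1 - β) * ρ) := by
          rw [Real.mul_rpow hC.le (Real.rpow_nonneg hT0 _), Real.rpow_mul hT0]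
      _ ≤ C ^ ρ * v := by
          gcongr
          exact rpow_le_rate hT1 hexpS
      _ ≤ C ^ ρ * (v * Real.log T) := by
          gcongr
          exact le_mul_of_one_le_right hv hlog'
  linarith

end Bandit

theorem corollary5 (M σ : ℝ) (hM : 0 < M) (hσ : 0 < σ) (Kbar : ℕ) (hK : 2 ≤ Kbar)
    (ρ : ℝ) (hρ : 0 ≤ ρ) :
    (∃ c : ℝ, 0 < c ∧ ∀ alg : Bandit.Algorithm,
      ENNReal.ofReal c <
        liminf (fun T : ℕ => Bandit.worstLoss M σ Kbar ρ alg T /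
          ENNReal.ofReal (max (√(T : ℝ)) (min ((T : ℝ) ^ (3 * ρ / (2 + 2 * ρ))) (T : ℝ))))
          atTop) ∧
    (ρ ≤ 2 → ∀ alg : Bandit.Algorithm,
      Bandit.IsUCB (fun t : ℕ =>
        (t : ℝ) ^ (max ((2 * ρ - 1) / (2 + 2 * ρ)) 0) * Real.log (t : ℝ)) alg →
      Bandit.IsSoftTheta (Bandit.worstLoss M σ Kbar ρ alg)
        (fun T : ℕ => max (√(T : ℝ)) ((T : ℝ) ^ (3 * ρ / (2 + 2 * ρ))))) := by
  obtain ⟨c, hc, hlower⟩ := Bandit.le_worstLoss hM hσ hK hρ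
  -- The liminf is only known to be at least `c`, so halving gives the strict inequality. The soft
  -- lower bound loses no logarithm, hence the exponent `0`.
  refine ⟨⟨c / 2, by positivity, fun alg => ?_⟩, fun hρ' alg halg => ⟨?_, 0, c, hc, ?_⟩⟩
  · refine lt_of_lt_of_le ((ENNReal.ofReal_lt_ofReal_iff hc).2 (half_lt_self hc)) ?_
    refine le_liminf_of_le (by isBoundedDefault) ?_
    filter_upwards [eventually_ge_atTop 1] with T hT
    have hpos := Bandit.rate_pos (ρ := ρ) hT
    rw [ENNReal.le_div_iff_mul_le (Or.inl (ENNReal.ofReal_pos.2 hpos).ne')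
      (Or.inl ENNReal.ofReal_ne_top),
      ← ENNReal.ofReal_mul hc.le]
    exact hlower alg T hT
  · obtain ⟨C, hC, hev⟩ := Bandit.worstLoss_ucb_le (Kbar := Kbar) hM hσ hρ hρ'
    refine ⟨1, C, hC, hev.mono fun T hT => ?_⟩
    rw [pow_one]
    exact hT alg halg
  · filter_upwards [eventually_ge_atTop 1] with T hT
    rw [pow_zero, div_one, ← Bandit.rate_eq hρ hρ' hT]
    exact hlower alg T hT
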